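/- Let $(X,d)$ be a totally bounded metric space with a Borel measure $\mu$ such that $0<\mu(B(x,r))<\infty$ for every ball. **Exponents.** $\mathcal P(X)$ is the set of measurable $p:X\to(0,\infty]$ with $\operatorname{ess\,inf}p>0$; $\mathcal P_b(X)$ is the set of real-valued, essentially bounded $p\in\mathcal P(X)$; $\mathcal P_b^{\log}(X)$ is the set of $p\in\mathcal P_b(X)$ for which there is $C>0$ with $|1/p(x)-1/p(y)|\le C/\log(e+1/d(x,y))$ for all $x\neq y$. Write $f\ll g$ if $\operatorname{ess\,inf}(g-f)>0$. **Spaces.** For $u:X\to[-\infty,\infty]$ measurable and a.e. finite and $p\in\mathcal P(X)$ put $\rho_{p(\cdot)}(u)=\int_X\varphi_{p(x)}(|u(x)|)\,d\mu(x)$, where $\varphi_p(t)=t^p$ for $p<\infty$ and $\varphi_\infty(t)=0$ if $t\le1$, $=\infty$ if $t>1$; $L^{p(\cdot)}$ is the set of $u$ with $\rho_{p(\cdot)}(\lambda u)<\infty$ for some $\lambda>0$, with $\|u\|_{L^{p(\cdot)}}=\inf\{\lambda>0:\rho_{p(\cdot)}(u/\lambda)\le1\}$. For sequences $g=(g_k)_{k\in\mathbb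 Z}$ of measurable functions put $\|g\|_{L^{p(\cdot)}(\ell^{q(\cdot)})}=\big\|\,\|(g_k(x))_k\|_{\ell^{q(x)}}\big\|_{L^{p(\cdot)}}$, and $\|g\|_{\ell^{q(\cdot)}(L^{p(\cdot)})}=\inf\{m>0:\rho(g/m)\le1\}$ with $\rho(g)=\sum_{k\in\mathbb Z}\inf\{\lambda>0:\rho_{p(\cdot)}(g_k/\lambda^{1/q(\cdot)})\le1\}$, $\lambda^{1/\infty}=1$ (with $\inf\emptyset=\infty$). A sequence $(g_k)_{k\in\mathbb Z}$ of measurable functions $X\to[0,\infty]$ is a vector $s(\cdot)$-gradient of $u$ if, outside a $\mu$-null set, $|u(x)-u(y)|\le d(x,y)^{s(x)}g_k(x)+d(x,y)^{s(y)}g_k(y)$ whenever $k\in\mathbb Z$ and $2^{-k-1}\le d(x,y)<2^{-k}$. The Hajłasz–Triebel–Lizorkin space $M^{s(\cdot)}_{p(\cdot),q(\cdot)}$ (resp. the Hajłasz–Besov space $N^{s(\cdot)}_{p(\cdot),q(\cdot)}$) consists of the $u\in L^{p(\cdot)}$ with finite quasi-norm $\|u\|_{L^{p(\cdot)}}+\inf_g\|g\|$,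 where $g$ runs over the vector $s(\cdot)$-gradients of $u$ and $\|g\|$ is the quasi-norm of $L^{p(\cdot)}(\ell^{q(\cdot)})$ (resp. of $\ell^{q(\cdot)}(L^{p(\cdot)})$); functions equal a.e. are identified. $C^{0,\lambda(\cdot)}(X,d)$ is the space of bounded continuous $v:X\to\mathbb R$ with finite norm $\sup_x|v(x)|+\sup_{x\ne y}|v(x)-v(y)|/d(x,y)^{\lambda(x)}$. A compact embedding $A\hookrightarrow\hookrightarrow C^{0,\lambda(\cdot)}(X,d)$ means: every $u\in A$ has a unique representative in $C^{0,\lambda(\cdot)}(X,d)$, the resulting linear map is bounded, and it maps bounded sequences to sequences with a subsequence converging in $C^{0,\lambda(\cdot)}(X,d)$. **Theorem.** Let $Q\in\mathcal P_b^{\log}(X)$ and suppose that $\mu$ is lower Ahlfors $Q(\cdot)$-regular: there is $b>0$ with $\mu(B(x,r))\ge b\,r^{Q(x)}$ for all $x\in X$, $r\in(0,1]$. Let $s,p\in\mathcal P_b^{\log}(X)$ with $Q\ll sp$. Then: 1. For every $q\in\mathcal P(X)$ and every $\lambda\in\mathcal P_b(X)$ with $\inf_{x\in X}\big(s(x)-Q(x)/p(x)-\lambda(x)\big)>0$,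 one has $M^{s(\cdot)}_{p(\cdot),q(\cdot)}\hookrightarrow\hookrightarrow C^{0,\lambda(\cdot)}(X,d)$. 2. For every $q\in\mathcal P(X)$ with $q\le p$ a.e. and every $\lambda$ as in 1, one has $N^{s(\cdot)}_{p(\cdot),q(\cdot)}\hookrightarrow\hookrightarrow C^{0,\lambda(\cdot)}(X,d)$. 3. For every $q\in\mathcal P(X)$, every $t\in\mathcal P_b^{\log}(X)$ with $Q\ll tp\ll sp$, and every $\lambda\in\mathcal P_b(X)$ with $\inf_{x\in X}\big(t(x)-Q(x)/p(x)-\lambda(x)\big)>0$, one has both $M^{s(\cdot)}_{p(\cdot),q(\cdot)}\hookrightarrow\hookrightarrow C^{0,\lambda(\cdot)}(X,d)$ and $N^{s(\cdot)}_{p(\cdot),q(\cdot)}\hookrightarrow\hookrightarrow C^{0,\lambda(\cdot)}(X,d)$. -/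

import Mathlib

open MeasureTheory Filter Topology Set
open scoped ENNReal NNReal

namespace VarExp

noncomputable section

/-! ### Exponents -/

/-- The class `P(X)` of variable exponents: measurable functions `p : X → (0, ∞]` with
`ess inf p > 0`. -/
structure IsExponent {X : Type*} [MeasurableSpace X] (μ : Measure X) (p : X → ℝ≥0∞) : Prop where
  measurable : Measurable p
  pos : ∀ x, 0 < p x
  ess_lower : ∃ c : ℝ≥0∞, 0 < c ∧ ∀ᵐ x ∂μ, c ≤ p x

/-- The class `P_b(X)` of bounded exponents, as real-valued functions: measurable, positive,
`ess inf p > 0` and `ess sup p < ∞`. -/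
structure IsBddExponent {X : Type*} [MeasurableSpace X] (μ : Measure X) (p : X → ℝ) : Prop where
  measurable : Measurable p
  pos : ∀ x, 0 < p x
  ess_lower : ∃ c : ℝ, 0 < c ∧ ∀ᵐ x ∂μ, c ≤ p x
  ess_upper : ∃ C : ℝ, ∀ᵐ x ∂μ, p x ≤ C

/-- Local log-Hölder continuity on the whole space. For `x = y` both sides are harmless: the
left-hand side vanishes and the right-hand side is nonnegative. -/
def LocLogHolder {X : Type*} [MetricSpace X] (f : X → ℝ) : Prop :=
  ∃ C : ℝ, 0 < C ∧ ∀ x y : X, |f x - f y| ≤ C / Real.log (Real.exp 1 + 1 / dist x y)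

/-- The class `P_b^log(X)`: bounded exponents `p` such that `1 / p` is locally log-Hölder
continuous. -/
structure IsBddLogExponent {X : Type*} [MetricSpace X] [MeasurableSpace X]
    (μ : Measure X) (p : X → ℝ) : Prop where
  bdd : IsBddExponent μ p
  logHolder : LocLogHolder (fun x => 1 / p x)

/-- The relation `f ≪ g`, that is, `ess inf (g - f) > 0`. -/
def EssLL {X : Type*} [MeasurableSpace X] (μ : Measure X) (f g : X → ℝ) : Prop :=
  ∃ c : ℝ, 0 < c ∧ ∀ᵐ x ∂μ, c ≤ g x - f x

/-- The relation `inf (g - f) > 0`, with the infimum over all points. -/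
def UnifLL {X : Type*} (f g : X → ℝ) : Prop :=
  ∃ c : ℝ, 0 < c ∧ ∀ x, c ≤ g x - f x

/-! ### Metric measure spaces -/

/-- The standing assumption: every ball has positive and finite measure. -/
def BallsPosFinite {X : Type*} [MetricSpace X] [MeasurableSpace X] (μ : Measure X) : Prop :=
  ∀ (x : X) (r : ℝ), 0 < r → 0 < μ (Metric.ball x r) ∧ μ (Metric.ball x r) < ∞

/-- Lower Ahlfors `Q(·)`-regularity. -/
def LowerAhlforsRegular {X : Type*} [MetricSpace X] [MeasurableSpace X] (μ : Measure X)
    (Q : X → ℝ) : Prop :=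
  ∃ b : ℝ, 0 < b ∧ ∀ (x : X) (r : ℝ), 0 < r → r ≤ 1 →
    ENNReal.ofReal (b * r ^ Q x) ≤ μ (Metric.ball x r)

/-! ### Variable exponent Lebesgue spaces -/

/-- The function `φ_p(t)`. -/
def phi (p t : ℝ≥0∞) : ℝ≥0∞ :=
  if p = ∞ then (if t ≤ 1 then 0 else ∞) else t ^ p.toReal

/-- The semi-modular `ρ_{p(·)}` of a nonnegative function. -/
def modular {X : Type*} [MeasurableSpace X] (μ : Measure X) (p f : X → ℝ≥0∞) : ℝ≥0∞ :=
  ∫⁻ x, phi (p x) (f x) ∂μ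

/-- The Luxemburg quasi-norm of a nonnegative function (`∞` if no admissible scale exists). -/
def lpNorm {X : Type*} [MeasurableSpace X] (μ : Measure X) (p f : X → ℝ≥0∞) : ℝ≥0∞ :=
  sInf {l : ℝ≥0∞ | 0 < l ∧ l < ∞ ∧ modular μ p (fun x => f x / l) ≤ 1}

/-- The space `L^{p(·)}(X, μ)`. -/
def MemLpVar {X : Type*} [MeasurableSpace X] (μ : Measure X) (p : X → ℝ≥0∞)
    (u : X → EReal) : Prop :=
  Measurable u ∧ ∃ l : ℝ≥0∞, 0 < l ∧ l < ∞ ∧ modular μ p (fun x => l * (u x).abs) < ∞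

/-! ### Mixed Lebesgue sequence spaces -/

/-- The norm of a nonnegative sequence in `ℓ^q`, `q ∈ (0, ∞]`. -/
def seqNorm (q : ℝ≥0∞) (a : ℤ → ℝ≥0∞) : ℝ≥0∞ :=
  if q = ∞ then ⨆ k, a k else (∑' k, a k ^ q.toReal) ^ (1 / q.toReal)

/-- The quasi-norm of `L^{p(·)}(ℓ^{q(·)})`. -/
def lpSeqNorm {X : Type*} [MeasurableSpace X] (μ : Measure X) (p q : X → ℝ≥0∞)
    (g : ℤ → X → ℝ≥0∞) : ℝ≥0∞ :=
  lpNorm μ p (fun x => seqNorm (q x) (fun k => g k x))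

/-- The semi-modular of `ℓ^{q(·)}(L^{p(·)})`. The exponent `1 / q(x)` is written
`((q x)⁻¹).toReal`, which is `0` for `q x = ∞`, so that `l ^ (1 / ∞) = 1`. -/
def seqLpModular {X : Type*} [MeasurableSpace X] (μ : Measure X) (p q : X → ℝ≥0∞)
    (g : ℤ → X → ℝ≥0∞) : ℝ≥0∞ :=
  ∑' k : ℤ, sInf {l : ℝ≥0∞ | 0 < l ∧ l < ∞ ∧
    modular μ p (fun x => g k x / l ^ ((q x)⁻¹).toReal) ≤ 1}

/-- The quasi-norm of `ℓ^{q(·)}(L^{p(·)})` (`∞` if no admissible scale exists). -/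
def seqLpNorm {X : Type*} [MeasurableSpace X] (μ : Measure X) (p q : X → ℝ≥0∞)
    (g : ℤ → X → ℝ≥0∞) : ℝ≥0∞ :=
  sInf {m : ℝ≥0∞ | 0 < m ∧ m < ∞ ∧ seqLpModular μ p q (fun k x => g k x / m) ≤ 1}

/-! ### Hajłasz–Triebel–Lizorkin and Hajłasz–Besov spaces -/

/-- `g = (g_k)` is a vector `s(·)`-gradient of `u`. -/
def IsVectorGradient {X : Type*} [MetricSpace X] [MeasurableSpace X] (μ : Measure X)
    (s : X → ℝ) (u : X → EReal) (g : ℤ → X → ℝ≥0∞) : Prop :=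
  (∀ k, Measurable (g k)) ∧
  ∃ N : Set X, μ N = 0 ∧ ∀ (k : ℤ) (x y : X), x ∉ N → y ∉ N →
    (2 : ℝ) ^ (-k - 1) ≤ dist x y → dist x y < (2 : ℝ) ^ (-k) →
      (u x - u y).abs ≤ edist x y ^ s x * g k x + edist x y ^ s y * g k y

/-- The quasi-seminorm of the homogeneous Hajłasz–Triebel–Lizorkin space. -/
def tlSeminorm {X : Type*} [MetricSpace X] [MeasurableSpace X] (μ : Measure X)
    (s p : X → ℝ) (q : X → ℝ≥0∞) (u : X → EReal) : ℝ≥0∞ :=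
  ⨅ (g : ℤ → X → ℝ≥0∞) (_ : IsVectorGradient μ s u g),
    lpSeqNorm μ (fun x => ENNReal.ofReal (p x)) q g

/-- The quasi-seminorm of the homogeneous Hajłasz–Besov space. -/
def besovSeminorm {X : Type*} [MetricSpace X] [MeasurableSpace X] (μ : Measure X)
    (s p : X → ℝ) (q : X → ℝ≥0∞) (u : X → EReal) : ℝ≥0∞ :=
  ⨅ (g : ℤ → X → ℝ≥0∞) (_ : IsVectorGradient μ s u g),
    seqLpNorm μ (fun x => ENNReal.ofReal (p x)) q g

/-- The Hajłasz–Triebel–Lizorkin space `M^{s(·)}_{p(·),q(·)}(X, d, μ)`. -/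
structure MemTL {X : Type*} [MetricSpace X] [MeasurableSpace X] (μ : Measure X)
    (s p : X → ℝ) (q : X → ℝ≥0∞) (u : X → EReal) : Prop where
  measurable : Measurable u
  finite_ae : ∀ᵐ x ∂μ, u x ≠ ⊤ ∧ u x ≠ ⊥
  memLp : MemLpVar μ (fun x => ENNReal.ofReal (p x)) u
  seminorm_lt_top : tlSeminorm μ s p q u < ∞

/-- The quasi-norm of `M^{s(·)}_{p(·),q(·)}(X, d, μ)`. -/
def tlNorm {X : Type*} [MetricSpace X] [MeasurableSpace X] (μ : Measure X)
    (s p : X → ℝ) (q : X → ℝ≥0∞) (u : X → EReal) : ℝ≥0∞ :=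
  lpNorm μ (fun x => ENNReal.ofReal (p x)) (fun x => (u x).abs) + tlSeminorm μ s p q u

/-- The Hajłasz–Besov space `N^{s(·)}_{p(·),q(·)}(X, d, μ)`. -/
structure MemBesov {X : Type*} [MetricSpace X] [MeasurableSpace X] (μ : Measure X)
    (s p : X → ℝ) (q : X → ℝ≥0∞) (u : X → EReal) : Prop where
  measurable : Measurable u
  finite_ae : ∀ᵐ x ∂μ, u x ≠ ⊤ ∧ u x ≠ ⊥
  memLp : MemLpVar μ (fun x => ENNReal.ofReal (p x)) u
  seminorm_lt_top : besovSeminorm μ s p q u < ∞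

/-- The quasi-norm of `N^{s(·)}_{p(·),q(·)}(X, d, μ)`. -/
def besovNorm {X : Type*} [MetricSpace X] [MeasurableSpace X] (μ : Measure X)
    (s p : X → ℝ) (q : X → ℝ≥0∞) (u : X → EReal) : ℝ≥0∞ :=
  lpNorm μ (fun x => ENNReal.ofReal (p x)) (fun x => (u x).abs) + besovSeminorm μ s p q u

/-! ### Hölder spaces -/

/-- The Hölder seminorm `[v]_{α(·),X}`. -/
def holderSeminorm {X : Type*} [MetricSpace X] (α : X → ℝ) (v : X → ℝ) : ℝ≥0∞ :=
  ⨆ (x : X) (y : X) (_ : x ≠ y), ‖v x - v y‖ₑ / edist x y ^ α x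

/-- The norm of `C^{0,α(·)}(X, d)`. -/
def holderNorm {X : Type*} [MetricSpace X] (α : X → ℝ) (v : X → ℝ) : ℝ≥0∞ :=
  (⨆ x, ‖v x‖ₑ) + holderSeminorm α v

/-- The Hölder space `C^{0,α(·)}(X, d)`: bounded continuous functions with finite seminorm. -/
def MemHolderVar {X : Type*} [MetricSpace X] (α : X → ℝ) (v : X → ℝ) : Prop :=
  Continuous v ∧ (⨆ x, ‖v x‖ₑ) < ∞ ∧ holderSeminorm α v < ∞

/-! ### Compact embeddings -/

/-- The continuous function `v` is a representative of `u`. -/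
def IsRep {X : Type*} [MeasurableSpace X] (μ : Measure X) (u : X → EReal) (v : X → ℝ) : Prop :=
  ∀ᵐ x ∂μ, u x = ((v x : ℝ) : EReal)

/-- The space of (classes of) functions given by the membership predicate `mem` and the quasi-norm
`nrm` embeds compactly into `C^{0,α(·)}(X, d)`: every element has exactly one representative in the
Hölder space, the resulting linear map is bounded, and it maps every bounded sequence to a sequence
that has a subsequence converging in the Hölder norm to an element of the Hölder space. -/
structure CompactEmbedsHolder {X : Type*} [MetricSpace X] [MeasurableSpace X] (μ : Measure X)
    (mem : (X → EReal) → Prop) (nrm : (X → EReal) → ℝ≥0∞) (α : X → ℝ) : Prop where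
  exists_rep : ∀ u, mem u → ∃! v : X → ℝ, MemHolderVar α v ∧ IsRep μ u v
  bounded : ∃ C : ℝ≥0, ∀ (u : X → EReal) (v : X → ℝ), mem u → MemHolderVar α v → IsRep μ u v →
    holderNorm α v ≤ C * nrm u
  compact : ∀ (u : ℕ → X → EReal) (v : ℕ → X → ℝ),
    (∀ n, mem (u n)) → (∃ C : ℝ≥0, ∀ n, nrm (u n) ≤ C) →
    (∀ n, MemHolderVar α (v n)) → (∀ n, IsRep μ (u n) (v n)) →
    ∃ (w : X → ℝ) (φ : ℕ → ℕ), MemHolderVar α w ∧ StrictMono φ ∧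
      Tendsto (fun n => holderNorm α (fun x => v (φ n) x - w x)) atTop (𝓝 0)

end

end VarExp

/-! Everything reduces to a scalar gradient `G` with `|f x - f y| ≤ d ^ t x * G x + d ^ t y * G y`
off a null set, where `f` and `G` are normalised in `L^{p(·)}`. By Chebyshev and the lower bound on
the measure, every ball of radius `r ≤ 1` about `x` contains a good point `y` with `G y ^ p y` and
`|f y| ^ p y` at most a constant times `r ^ (-Q x)` (`exists_good_point`). Log-Hölder continuity
moves exponents from `y` to `x` at bounded cost, so `r ^ t y * G y` is at most a constant times `r ^
(t x - Q x / p x)`. Since `Q ≪ tp`, this exponent `α = t - Q / p` is bounded below by a positive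
constant; telescoping over good points at dyadic radii compares `f x` with a nearby good value
(`exists_good_point_near`). Hence `f` is bounded and `α(·)`-Hölder off a null set
(`exists_pointwise_bound`). No averages or Lebesgue points are involved.

Null sets have dense complement, so `f` extends continuously with the same bounds. Compactness is
Arzelà–Ascoli followed by interpolation between the sup norm and the `α(·)`-seminorm, which uses the
gap between `λ` and `α` (`compactEmbedsHolder_of_ae_bound`).

The scalar gradient is a supremum over the shells. In the Triebel–Lizorkin case `⨆ k, g k` is below
the `ℓ^q` norm. In the Besov case with `q ≤ p`, the modulars of the `g k` are summable
(`lintegral_rpow_le_level`). For general `q` they are only bounded, and lowering the smoothness from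
`s` to `t` supplies summable geometric weights (`exists_weight`). -/

namespace VarExp

/-! ### Log-Hölder continuous functions -/

section LogHolder

variable {X : Type*} [MetricSpace X] {f g : X → ℝ}

lemma one_le_log_exp_add (x y : X) : 1 ≤ Real.log (Real.exp 1 + 1 / dist x y) := by
  have h : 0 ≤ 1 / dist x y := by positivity
  calc (1 : ℝ) = Real.log (Real.exp 1) := (Real.log_exp 1).symm
    _ ≤ _ := Real.log_le_log (Real.exp_pos 1) (by linarith)

lemma LocLogHolder.sub (hf : LocLogHolder f) (hg : LocLogHolder g) :
    LocLogHolder (fun x => f x - g x) := by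
  obtain ⟨C, hC, h⟩ := hf
  obtain ⟨D, hD, h'⟩ := hg
  refine ⟨C + D, by linarith, fun x y => ?_⟩
  have h1 := h x y
  have h2 := h' x y
  rw [add_div]
  calc |f x - g x - (f y - g y)| = |(f x - f y) - (g x - g y)| := by ring_nf
    _ ≤ |f x - f y| + |g x - g y| := abs_sub _ _
    _ ≤ _ := add_le_add h1 h2

lemma LocLogHolder.mul (hf : LocLogHolder f) (hg : LocLogHolder g) {A B : ℝ}
    (hA : ∀ x, |f x| ≤ A) (hB : ∀ x, |g x| ≤ B) :
    LocLogHolder (fun x => f x * g x) := by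
  obtain ⟨C, hC, h⟩ := hf
  obtain ⟨D, hD, h'⟩ := hg
  refine ⟨(|A| + 1) * D + C * (|B| + 1), by positivity, fun x y => ?_⟩
  have h1 := h x y
  have h2 := h' x y
  rw [add_div, mul_div_assoc, mul_div_right_comm]
  calc |f x * g x - f y * g y| = |f x * (g x - g y) + (f x - f y) * g y| := by ring_nf
    _ ≤ |f x| * |g x - g y| + |f x - f y| * |g y| := by
      rw [← abs_mul, ← abs_mul]; exact abs_add_le _ _
    _ ≤ _ := by
      have h3 := (abs_nonneg _).trans h1
      gcongr
      · linarith [hA x, le_abs_self A]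
      · linarith [hB y, le_abs_self B]

/-- From `f x - f y = f x * f y * (1 / f y - 1 / f x)`. The exponent classes constrain reciprocals,
while `Q` and `t` enter the estimates directly. -/
lemma LocLogHolder.of_inv (hf : LocLogHolder (fun x => 1 / f x)) (hpos : ∀ x, 0 < f x) {A : ℝ}
    (hA : ∀ x, f x ≤ A) : LocLogHolder f := by
  obtain ⟨C, hC, h⟩ := hf
  refine ⟨(|A| + 1) * (|A| + 1) * C, by positivity, fun x y => ?_⟩
  have h1 := h x y
  have hx := hpos x
  have hy := hpos y
  have e : f x - f y = f x * f y * (1 / f y - 1 / f x) := by field_simp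
  rw [mul_div_assoc, e, abs_mul, abs_of_pos (mul_pos hx hy), abs_sub_comm]
  gcongr
  · linarith [hA x, le_abs_self A]
  · linarith [hA y, le_abs_self A]

lemma LocLogHolder.continuous (hf : LocLogHolder f) : Continuous f := by
  obtain ⟨C, hC, h⟩ := hf
  rw [continuous_iff_continuousAt]
  intro x
  -- At `y = x` the convention `1 / 0 = 0` makes the bound equal to `C`, so it tends to zero only
  -- along punctured neighbourhoods.
  rw [continuousAt_iff_punctured_nhds]
  have hd : Tendsto (fun y => dist y x) (𝓝[≠] x) (𝓝[>] 0) := by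
    refine tendsto_nhdsWithin_iff.2 ⟨?_, ?_⟩
    · have : Tendsto (fun y => dist y x) (𝓝 x) (𝓝 (dist x x)) :=
        (continuous_id.dist continuous_const).tendsto x
      rw [dist_self] at this
      exact this.mono_left nhdsWithin_le_nhds
    · filter_upwards [self_mem_nhdsWithin] with y hy
      exact dist_pos.2 hy
  have h1 : Tendsto (fun y => C / Real.log (Real.exp 1 + 1 / dist y x)) (𝓝[≠] x) (𝓝 0) := by
    refine Tendsto.const_div_atTop (Real.tendsto_log_atTop.comp ?_) C
    refine tendsto_atTop_add_const_left _ _ ?_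
    simpa only [one_div, Function.comp_def] using tendsto_inv_nhdsGT_zero.comp hd
  rw [tendsto_iff_dist_tendsto_zero]
  exact squeeze_zero (fun _ => dist_nonneg) (fun y => by rw [Real.dist_eq]; exact h y x) h1

/-- Powers with a log-Hölder continuous exponent are comparable at the scale of the distance. -/
lemma LocLogHolder.exists_rpow_le (hf : LocLogHolder f) :
    ∃ K : ℝ, 1 ≤ K ∧ ∀ (x y : X) (r : ℝ), 0 < r → r ≤ 1 → dist x y ≤ r →
      r ^ f y ≤ K * r ^ f x := by
  obtain ⟨C, hC, h⟩ := hf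
  refine ⟨Real.exp C, Real.one_le_exp hC.le, fun x y r hr hr1 hd => ?_⟩
  rcases eq_or_ne x y with rfl | hxy
  · exact le_mul_of_one_le_left (by positivity) (Real.one_le_exp hC.le)
  have hd0 : 0 < dist x y := dist_pos.2 hxy
  have hl := one_le_log_exp_add x y
  have h1 := h x y
  rw [le_div_iff₀ (by linarith)] at h1
  -- As `d ≤ r`, the logarithmic denominator dominates `-log r`, so `|f x - f y| * (-log r) ≤ C`.
  have h2 : -Real.log r ≤ Real.log (Real.exp 1 + 1 / dist x y) := by
    rw [← Real.log_inv]
    apply Real.log_le_log (by positivity)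
    rw [← one_div]
    have := one_div_le_one_div_of_le hd0 hd
    linarith [Real.exp_pos 1]
  have h3 : 0 ≤ -Real.log r := by linarith [Real.log_nonpos hr.le hr1]
  rw [Real.rpow_def_of_pos hr, Real.rpow_def_of_pos hr, ← Real.exp_add, Real.exp_le_exp]
  have h4 : -Real.log r * (f x - f y) ≤ C :=
    calc -Real.log r * (f x - f y) ≤ -Real.log r * |f x - f y| :=
          mul_le_mul_of_nonneg_left (le_abs_self _) h3
      _ ≤ Real.log (Real.exp 1 + 1 / dist x y) * |f x - f y| :=
          mul_le_mul_of_nonneg_right h2 (abs_nonneg _)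
      _ ≤ C := by linarith
  linarith

end LogHolder

/-! ### Almost everywhere bounds hold everywhere -/

section Bounds

variable {X : Type*} [MetricSpace X] [MeasurableSpace X] {μ : Measure X}

lemma BallsPosFinite.isOpenPosMeasure (hμ : BallsPosFinite μ) : μ.IsOpenPosMeasure := by
  refine ⟨fun U hU ⟨x, hx⟩ h0 => ?_⟩
  obtain ⟨r, hr, hsub⟩ := Metric.isOpen_iff.1 hU x hx
  exact (hμ x r hr).1.ne' (measure_mono_null hsub h0)

/-- The set where the inequality holds is closed, and dense because it has full measure. -/
lemma forall_le_of_ae_le [μ.IsOpenPosMeasure] {f g : X → ℝ} (hf : Continuous f)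
    (hg : Continuous g) (h : ∀ᵐ x ∂μ, f x ≤ g x) (x : X) : f x ≤ g x := by
  have hd : Dense {x | f x ≤ g x} := Measure.dense_of_ae h
  have hc : IsClosed {x | f x ≤ g x} := isClosed_le hf hg
  have := hc.closure_eq ▸ hd x
  exact this

lemma IsBddLogExponent.continuous {p : X → ℝ} (hp : IsBddLogExponent μ p) : Continuous p := by
  have h := hp.logHolder.continuous
  have h2 : Continuous fun x => (1 / p x)⁻¹ :=
    h.inv₀ fun x => one_div_ne_zero (hp.bdd.pos x).ne'
  simpa using h2

lemma IsBddLogExponent.exists_bounds [μ.IsOpenPosMeasure] {p : X → ℝ}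
    (hp : IsBddLogExponent μ p) :
    ∃ c C : ℝ, 0 < c ∧ 0 < C ∧ ∀ x, c ≤ p x ∧ p x ≤ C := by
  obtain ⟨c, hc, h⟩ := hp.bdd.ess_lower
  obtain ⟨C, h'⟩ := hp.bdd.ess_upper
  refine ⟨c, |C| + 1, hc, by positivity, fun x => ⟨?_, ?_⟩⟩
  · exact forall_le_of_ae_le continuous_const hp.continuous h x
  · have := forall_le_of_ae_le hp.continuous continuous_const h' x
    linarith [le_abs_self C]

lemma IsBddLogExponent.logHolder_self [μ.IsOpenPosMeasure] {p : X → ℝ}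
    (hp : IsBddLogExponent μ p) : LocLogHolder p := by
  obtain ⟨c, C, _, _, h⟩ := hp.exists_bounds
  exact hp.logHolder.of_inv hp.bdd.pos fun x => (h x).2

end Bounds

/-! ### Pointwise estimates for functions with a Hajłasz gradient -/

section Core

variable {X : Type*} [MetricSpace X] [MeasurableSpace X] {μ : Measure X}

/-- The quantitative form of the assumptions on the measure, on the smoothness `t`, and on the
exponents `p` and `Q`. -/
structure AdmissibleData (μ : Measure X) (Q t p : X → ℝ) (b K c S a : ℝ) : Prop where
  b_pos : 0 < b
  one_le_K : 1 ≤ K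
  c_pos : 0 < c
  a_pos : 0 < a
  measure_ball : ∀ (x : X) (r : ℝ), 0 < r → r ≤ 1 →
    ENNReal.ofReal (b * r ^ Q x) ≤ μ (Metric.ball x r)
  le_p : ∀ x, c ≤ p x
  t_pos : ∀ x, 0 < t x
  t_le : ∀ x, t x ≤ S
  le_smoothness : ∀ x, a ≤ t x - Q x / p x
  rpow_Q : ∀ (x y : X) (r : ℝ), 0 < r → r ≤ 1 → dist x y ≤ r → r ^ Q y ≤ K * r ^ Q x
  rpow_smoothness : ∀ (x y : X) (r : ℝ), 0 < r → r ≤ 1 → dist x y ≤ r →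
    r ^ (t y - Q y / p y) ≤ K * r ^ (t x - Q x / p x)

variable {Q t p : X → ℝ} {b K c S a : ℝ}

/-- The constant in `AdmissibleData.exists_good_point`. -/
noncomputable def goodConst (b K c : ℝ) : ℝ := (1 + 3 * K / b) ^ (1 / c) * K

/-- The constant in `AdmissibleData.exists_good_point_near`. -/
noncomputable def nearConst (b K c S a : ℝ) : ℝ :=
  2 * 4 ^ S * goodConst b K c / (1 - (1 / 2) ^ a)

namespace AdmissibleData

lemma goodConst_nonneg (H : AdmissibleData μ Q t p b K c S a) : 0 ≤ goodConst b K c := by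
  have := H.b_pos
  have := H.one_le_K
  unfold goodConst
  positivity

/-- Split `r ^ t y` as `r ^ (Q y / p y) * r ^ (t y - Q y / p y)`: the first factor balances the size
of `v`, the second is moved to `x` by log-Hölder continuity. The summand `1` in `goodConst` keeps
the base at least one, so `1 / p y` may be replaced by `1 / c`. -/
lemma rpow_mul_le (H : AdmissibleData μ Q t p b K c S a) {x y : X} {r v : ℝ} (hr : 0 < r)
    (hr1 : r ≤ 1) (hd : dist x y ≤ r) (hv : 0 ≤ v) (h : v ^ p y ≤ 3 / (b * r ^ Q x)) :
    r ^ t y * v ≤ goodConst b K c * r ^ (t x - Q x / p x) := by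
  have hb := H.b_pos
  have hK := H.one_le_K
  have hp : 0 < p y := H.c_pos.trans_le (H.le_p y)
  have hQx : 0 < r ^ Q x := Real.rpow_pos_of_pos hr _
  have h1 : r ^ Q y * v ^ p y ≤ 1 + 3 * K / b :=
    calc r ^ Q y * v ^ p y ≤ (K * r ^ Q x) * (3 / (b * r ^ Q x)) := by
          gcongr
          exact H.rpow_Q x y r hr hr1 hd
      _ = 3 * K / b := by field_simp
      _ ≤ _ := by linarith
  have h2 : r ^ (Q y / p y) * v ≤ (1 + 3 * K / b) ^ (1 / c) := by
    have e : r ^ (Q y / p y) * v = (r ^ Q y * v ^ p y) ^ (1 / p y) := by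
      rw [Real.mul_rpow (by positivity) (by positivity), ← Real.rpow_mul hr.le,
        ← Real.rpow_mul hv, mul_one_div, mul_one_div, div_self hp.ne', Real.rpow_one]
    rw [e]
    calc (r ^ Q y * v ^ p y) ^ (1 / p y) ≤ (1 + 3 * K / b) ^ (1 / p y) := by gcongr
      _ ≤ (1 + 3 * K / b) ^ (1 / c) := by
        apply Real.rpow_le_rpow_of_exponent_le
        · have : 0 ≤ 3 * K / b := by positivity
          linarith
        · exact one_div_le_one_div_of_le H.c_pos (H.le_p y)
  calc r ^ t y * v = (r ^ (Q y / p y) * v) * r ^ (t y - Q y / p y) := by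
        rw [mul_right_comm, ← Real.rpow_add hr]; congr 2; ring
    _ ≤ (1 + 3 * K / b) ^ (1 / c) * (K * r ^ (t x - Q x / p x)) := by
        gcongr
        exact H.rpow_smoothness x y r hr hr1 hd
    _ = _ := by unfold goodConst; ring

/-- Every small ball contains a point, outside a given null set, at which the gradient and the
function are controlled by the lower bound for the measure. -/
lemma exists_good_point [BorelSpace X] (H : AdmissibleData μ Q t p b K c S a) {N : Set X}
    (hN : μ N = 0) {f G : X → ℝ} (hG : ∀ x, 0 ≤ G x)
    (hint : ∫⁻ x, ENNReal.ofReal (G x ^ p x + |f x| ^ p x) ∂μ ≤ 2) (x : X) {r : ℝ} (hr : 0 < r)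
    (hr1 : r ≤ 1) :
    ∃ y, dist x y < r ∧ y ∉ N ∧ r ^ t y * G y ≤ goodConst b K c * r ^ (t x - Q x / p x) ∧
      r ^ t y * |f y| ≤ goodConst b K c * r ^ (t x - Q x / p x) := by
  have hA : 0 < b * r ^ Q x := mul_pos H.b_pos (Real.rpow_pos_of_pos hr _)
  obtain ⟨y, hy, hyN, hle⟩ : ∃ y ∈ Metric.ball x r, y ∉ N ∧
      G y ^ p y + |f y| ^ p y ≤ 3 / (b * r ^ Q x) := by
    -- Otherwise the integral over the ball would be at least `3`, against the bound `2`.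
    by_contra! hcon
    have h1 : ENNReal.ofReal (3 / (b * r ^ Q x)) * μ (Metric.ball x r) ≤ 2 := by
      rw [← setLIntegral_const]
      refine le_trans (lintegral_mono_ae ?_) ((setLIntegral_le_lintegral _ _).trans hint)
      rw [ae_restrict_iff' Metric.isOpen_ball.measurableSet]
      filter_upwards [measure_eq_zero_iff_ae_notMem.1 hN] with y hyN hy
      exact ENNReal.ofReal_le_ofReal (hcon y hy hyN).le
    have h2 : ENNReal.ofReal 3 ≤ 2 := by
      refine le_trans (le_trans ?_ (mul_le_mul_right (H.measure_ball x r hr hr1) _)) h1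
      rw [← ENNReal.ofReal_mul (by positivity), div_mul_cancel₀ _ hA.ne']
    rw [show (2 : ℝ≥0∞) = ENNReal.ofReal 2 by simp,
      ENNReal.ofReal_le_ofReal_iff (by norm_num)] at h2
    norm_num at h2
  have hd : dist x y < r := by rw [dist_comm]; exact hy
  have hG' : 0 ≤ G y ^ p y := Real.rpow_nonneg (hG y) _
  have hf' : 0 ≤ |f y| ^ p y := Real.rpow_nonneg (abs_nonneg _) _
  exact ⟨y, hd, hyN, H.rpow_mul_le hr hr1 hd.le (hG y) (by linarith),
    H.rpow_mul_le hr hr1 hd.le (abs_nonneg _) (by linarith)⟩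

lemma half_rpow_lt_one (H : AdmissibleData μ Q t p b K c S a) : (1 / 2 : ℝ) ^ a < 1 :=
  Real.rpow_lt_one (by norm_num) (by norm_num) H.a_pos

lemma nearConst_nonneg (H : AdmissibleData μ Q t p b K c S a) : 0 ≤ nearConst b K c S a := by
  have := H.goodConst_nonneg
  have : 0 < 1 - (1 / 2 : ℝ) ^ a := by linarith [H.half_rpow_lt_one]
  unfold nearConst
  positivity

/-- Enlarging the scale by a factor `m ≥ 1` costs `m ^ t y ≤ m ^ S`, uniformly in `y`. -/
lemma mul_rpow_mul_le (H : AdmissibleData μ Q t p b K c S a) {y : X} {d m r v B : ℝ}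
    (hd : 0 ≤ d) (hr : 0 < r) (hm : 1 ≤ m) (hdr : d ≤ m * r) (hv : 0 ≤ v)
    (h : r ^ t y * v ≤ B) : d ^ t y * v ≤ m ^ S * B :=
  calc d ^ t y * v ≤ (m * r) ^ t y * v := by
        gcongr
        exact (H.t_pos y).le
    _ = m ^ t y * (r ^ t y * v) := by rw [Real.mul_rpow (by linarith) hr.le, mul_assoc]
    _ ≤ m ^ S * B := by
        have : 0 ≤ r ^ t y * v := by positivity
        gcongr
        exact H.t_le y

/-- Telescoping along good points converging to `x`. -/
lemma exists_good_point_near [BorelSpace X] (H : AdmissibleData μ Q t p b K c S a) {N : Set X}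
    (hN : μ N = 0) {f G : X → ℝ} (hG : ∀ x, 0 ≤ G x)
    (hint : ∫⁻ x, ENNReal.ofReal (G x ^ p x + |f x| ^ p x) ∂μ ≤ 2)
    (hgrad : ∀ x y, x ∉ N → y ∉ N →
      |f x - f y| ≤ dist x y ^ t x * G x + dist x y ^ t y * G y)
    {x : X} (hx : x ∉ N) {r : ℝ} (hr : 0 < r) (hr1 : r ≤ 1) :
    ∃ y, dist x y < r ∧ y ∉ N ∧ r ^ t y * G y ≤ goodConst b K c * r ^ (t x - Q x / p x) ∧
      r ^ t y * |f y| ≤ goodConst b K c * r ^ (t x - Q x / p x) ∧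
      |f x - f y| ≤ nearConst b K c S a * r ^ (t x - Q x / p x) := by
  set α : ℝ := t x - Q x / p x with hα
  have hα0 : 0 < α := H.a_pos.trans_le (H.le_smoothness x)
  set C := goodConst b K c
  have hC : 0 ≤ C := H.goodConst_nonneg
  set ρ : ℕ → ℝ := fun j => r * (1 / 2) ^ j with hρ
  have hρ0 : ∀ j, 0 < ρ j := fun j => by positivity
  have hhalf : ∀ j : ℕ, (1 / 2 : ℝ) ^ j ≤ 1 := fun j => pow_le_one₀ (by norm_num) (by norm_num)
  have hρr : ∀ j, ρ j ≤ r := fun j => mul_le_of_le_one_right hr.le (hhalf j)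
  have hρ1 : ∀ j, ρ j ≤ 1 := fun j => (hρr j).trans hr1
  have hρs : ∀ j, ρ j = 2 * ρ (j + 1) := fun j => by simp only [hρ]; ring
  have hlim : Tendsto ρ atTop (𝓝 0) := by
    simpa [hρ] using (tendsto_pow_atTop_nhds_zero_of_lt_one (r := (1 / 2 : ℝ)) (by norm_num)
      (by norm_num)).const_mul r
  choose y hyd hyN hyG hyf using fun j => H.exists_good_point hN hG hint x (hρ0 j) (hρ1 j)
  have hρα : ∀ j, ρ j ^ α ≤ r ^ α * ((1 / 2 : ℝ) ^ a) ^ j := fun j => by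
    rw [Real.mul_rpow hr.le (by positivity), ← Real.rpow_natCast, ← Real.rpow_natCast,
      ← Real.rpow_mul (by norm_num), ← Real.rpow_mul (by norm_num)]
    refine mul_le_mul_of_nonneg_left ?_ (by positivity)
    apply Real.rpow_le_rpow_of_exponent_ge (by norm_num) (by norm_num)
    rw [mul_comm]
    exact mul_le_mul_of_nonneg_left (H.le_smoothness x) (Nat.cast_nonneg j)
  -- Consecutive good points are within `ρ j + ρ (j + 1) = 3 * ρ (j + 1)`; the constant `4` is
  -- generous. The ratio `(1 / 2) ^ a` is uniform in `x` because `α ≥ a`.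
  have hstep : ∀ j, dist (f (y j)) (f (y (j + 1))) ≤
      (2 * 4 ^ S * C * r ^ α) * ((1 / 2 : ℝ) ^ a) ^ j := fun j => by
    have hdist : dist (y j) (y (j + 1)) ≤ 4 * ρ (j + 1) := by
      have h1 := dist_triangle_left (y j) (y (j + 1)) x
      linarith [hyd j, hyd (j + 1), hρs j, hρ0 (j + 1)]
    have hdist' : dist (y j) (y (j + 1)) ≤ 4 * ρ j := by linarith [hρs j, hρ0 (j + 1)]
    have h1 := H.mul_rpow_mul_le dist_nonneg (hρ0 j) (by norm_num) hdist' (hG _) (hyG j)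
    have h2 := H.mul_rpow_mul_le dist_nonneg (hρ0 (j + 1)) (by norm_num) hdist (hG _)
      (hyG (j + 1))
    rw [Real.dist_eq]
    calc |f (y j) - f (y (j + 1))| ≤ 4 ^ S * (C * ρ j ^ α) + 4 ^ S * (C * ρ (j + 1) ^ α) :=
          (hgrad _ _ (hyN j) (hyN (j + 1))).trans (add_le_add h1 h2)
      _ ≤ 4 ^ S * (C * ρ j ^ α) + 4 ^ S * (C * ρ j ^ α) := by
          gcongr
          linarith [hρs j, hρ0 (j + 1)]
      _ = 2 * 4 ^ S * C * ρ j ^ α := by ring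
      _ ≤ 2 * 4 ^ S * C * (r ^ α * ((1 / 2 : ℝ) ^ a) ^ j) := by
          gcongr
          exact hρα j
      _ = _ := by ring
  -- The gradient inequality is applied at `x` itself: `G x` is a fixed real number multiplied by `ρ
  -- j ^ t x → 0`, and the term at `y j` is small since `y j` is good.
  have htend : Tendsto (fun j => f (y j)) atTop (𝓝 (f x)) := by
    rw [tendsto_iff_dist_tendsto_zero]
    have hz : Tendsto (fun j => ρ j ^ t x * G x + C * ρ j ^ α) atTop (𝓝 0) := by
      have h1 := (hlim.rpow_const (p := t x) (Or.inr (H.t_pos x).le)).mul_const (G x)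
      have h2 := (hlim.rpow_const (p := α) (Or.inr hα0.le)).const_mul C
      rw [Real.zero_rpow (H.t_pos x).ne', zero_mul] at h1
      rw [Real.zero_rpow hα0.ne', mul_zero] at h2
      simpa using h1.add h2
    refine squeeze_zero (fun _ => dist_nonneg) (fun j => ?_) hz
    rw [dist_comm, Real.dist_eq]
    refine (hgrad x (y j) hx (hyN j)).trans (add_le_add ?_ ?_)
    · refine mul_le_mul_of_nonneg_right ?_ (hG x)
      exact Real.rpow_le_rpow dist_nonneg (hyd j).le (H.t_pos x).le
    · refine le_trans (mul_le_mul_of_nonneg_right ?_ (hG (y j))) (hyG j)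
      exact Real.rpow_le_rpow dist_nonneg (hyd j).le (H.t_pos (y j)).le
  have hfin := dist_le_of_le_geometric_of_tendsto₀ _ _ H.half_rpow_lt_one hstep htend
  have e : ρ 0 = r := by simp [hρ]
  refine ⟨y 0, e ▸ hyd 0, hyN 0, e ▸ hyG 0, e ▸ hyf 0, ?_⟩
  rw [← Real.dist_eq, dist_comm]
  refine hfin.trans_eq ?_
  unfold nearConst
  ring

/-- The pointwise bounds, for normalised functions. -/
lemma exists_pointwise_bound [BorelSpace X] (H : AdmissibleData μ Q t p b K c S a) :
    ∃ C : ℝ, 0 ≤ C ∧ ∀ (N : Set X) (f G : X → ℝ), μ N = 0 → (∀ x, 0 ≤ G x) →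
      ∫⁻ x, ENNReal.ofReal (G x ^ p x + |f x| ^ p x) ∂μ ≤ 2 →
      (∀ x y, x ∉ N → y ∉ N → |f x - f y| ≤ dist x y ^ t x * G x + dist x y ^ t y * G y) →
      (∀ x, x ∉ N → |f x| ≤ C) ∧
      ∀ x y, x ∉ N → y ∉ N → |f x - f y| ≤ C * dist x y ^ (t x - Q x / p x) := by
  set A := goodConst b K c
  have hA : 0 ≤ A := H.goodConst_nonneg
  set B := nearConst b K c S a
  have hB : 0 ≤ B := H.nearConst_nonneg
  have hK : 0 ≤ K := zero_le_one.trans H.one_le_K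
  have hD : 0 ≤ B + B * K + 3 ^ S * A + 3 ^ S * (A * K) := by positivity
  refine ⟨2 * (A + B) + (B + B * K + 3 ^ S * A + 3 ^ S * (A * K)), by positivity, ?_⟩
  intro N f G hN hG hint hgrad
  have hsup : ∀ x, x ∉ N → |f x| ≤ A + B := fun x hx => by
    obtain ⟨y, -, -, -, h1, h2⟩ := H.exists_good_point_near hN hG hint hgrad hx one_pos le_rfl
    simp only [Real.one_rpow, one_mul, mul_one] at h1 h2
    have h3 := abs_add_le (f x - f y) (f y)
    rw [sub_add_cancel] at h3
    linarith
  refine ⟨fun x hx => (hsup x hx).trans (by linarith), fun x y hx hy => ?_⟩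
  have hα0 : 0 < t x - Q x / p x := H.a_pos.trans_le (H.le_smoothness x)
  set α := t x - Q x / p x with hα
  rcases eq_or_ne x y with rfl | hxy
  · simp [Real.zero_rpow hα0.ne']
  set d := dist x y with hd
  have hd0 : 0 < d := dist_pos.2 hxy
  -- At distance at most one, go from `x` to `y` through good points chosen at scale `d` near each.
  -- Beyond distance one the sup bound suffices, since `d ^ α ≥ 1`.
  rcases le_total d 1 with hd1 | hd1
  · obtain ⟨y₁, hy₁d, hy₁N, hy₁G, -, hy₁f⟩ :=
      H.exists_good_point_near hN hG hint hgrad hx hd0 hd1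
    obtain ⟨y₂, hy₂d, hy₂N, hy₂G, -, hy₂f⟩ :=
      H.exists_good_point_near hN hG hint hgrad hy hd0 hd1
    have hcmp := H.rpow_smoothness x y d hd0 hd1 le_rfl
    rw [← hα] at hcmp hy₁G hy₁f
    have hdist : dist y₁ y₂ ≤ 3 * d := by
      have h1 := dist_triangle4 y₁ x y y₂
      rw [dist_comm y₁ x] at h1
      linarith
    have h1 := H.mul_rpow_mul_le dist_nonneg hd0 (by norm_num) hdist (hG _) hy₁G
    have h2 := H.mul_rpow_mul_le dist_nonneg hd0 (by norm_num) hdist (hG _) hy₂G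
    have h3 := hgrad y₁ y₂ hy₁N hy₂N
    have h4 : B * d ^ (t y - Q y / p y) ≤ B * (K * d ^ α) := by gcongr
    have h5 : (3 : ℝ) ^ S * (A * d ^ (t y - Q y / p y)) ≤ 3 ^ S * (A * (K * d ^ α)) := by gcongr
    have h6 : |f x - f y| ≤ |f x - f y₁| + |f y₁ - f y₂| + |f y - f y₂| := by
      have e : f x - f y = (f x - f y₁) + (f y₁ - f y₂) + -(f y - f y₂) := by ring
      rw [e]
      refine (abs_add_le _ _).trans ?_
      rw [abs_neg]
      gcongr
      exact abs_add_le _ _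
    have h7 : 0 ≤ 2 * (A + B) * d ^ α := by positivity
    calc |f x - f y| ≤ (B + B * K + 3 ^ S * A + 3 ^ S * (A * K)) * d ^ α := by
          linarith
      _ ≤ _ := by rw [add_mul]; linarith
  · have h1 : 1 ≤ d ^ α := Real.one_le_rpow hd1 hα0.le
    have h2 : |f x - f y| ≤ 2 * (A + B) := by
      have := abs_sub (f x) (f y)
      linarith [hsup x hx, hsup y hy]
    have h3 : 2 * (A + B) ≤ 2 * (A + B) + (B + B * K + 3 ^ S * A + 3 ^ S * (A * K)) := by linarith
    refine (h2.trans h3).trans (le_mul_of_one_le_right (by positivity) h1)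

end AdmissibleData

end Core

/-! ### Scalar gradients and Hölder bounds off a null set -/

lemma phi_ofReal (p : ℝ) (hp : 0 ≤ p) (a : ℝ≥0∞) : phi (ENNReal.ofReal p) a = a ^ p := by
  rw [phi, if_neg ENNReal.ofReal_ne_top, ENNReal.toReal_ofReal hp]

lemma modular_ofReal {X : Type*} [MeasurableSpace X] {μ : Measure X} {p : X → ℝ}
    (hp : ∀ x, 0 < p x) (f : X → ℝ≥0∞) :
    modular μ (fun x => ENNReal.ofReal (p x)) f = ∫⁻ x, f x ^ p x ∂μ :=
  lintegral_congr fun x => phi_ofReal _ (hp x).le _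

section Hajlasz

variable {X : Type*} [MetricSpace X] [MeasurableSpace X] {μ : Measure X} {Q t p : X → ℝ}

/-- Continuity turns the essential bounds into pointwise ones. From `t - Q / p = (t * p - Q) / p`, a
gap `ε` in `Q ≪ tp` leaves smoothness at least `ε / Cp`. -/
lemma exists_admissibleData (hμ : BallsPosFinite μ) (hQ : IsBddLogExponent μ Q)
    (ht : IsBddLogExponent μ t) (hp : IsBddLogExponent μ p) (hreg : LowerAhlforsRegular μ Q)
    (htp : EssLL μ Q (fun x => t x * p x)) :
    ∃ b K c S a : ℝ, AdmissibleData μ Q t p b K c S a := by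
  have := hμ.isOpenPosMeasure
  obtain ⟨b, hb, hball⟩ := hreg
  obtain ⟨cQ, CQ, hcQ, hCQ, hQb⟩ := hQ.exists_bounds
  obtain ⟨ct, Ct, hct, hCt, htb⟩ := ht.exists_bounds
  obtain ⟨cp, Cp, hcp, hCp, hpb⟩ := hp.exists_bounds
  obtain ⟨ε, hε, hεle⟩ := htp
  have hε' := forall_le_of_ae_le (μ := μ) continuous_const
    ((ht.continuous.mul hp.continuous).sub hQ.continuous) hεle
  have hlogα : LocLogHolder (fun x => t x - Q x / p x) := by
    have h1 : LocLogHolder (fun x => Q x * (1 / p x)) := by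
      refine hQ.logHolder_self.mul hp.logHolder (A := CQ) (B := 1 / cp) (fun x => ?_)
        (fun x => ?_)
      · rw [abs_of_pos (hQ.bdd.pos x)]; exact (hQb x).2
      · rw [abs_of_pos (one_div_pos.2 (hp.bdd.pos x))]
        exact one_div_le_one_div_of_le hcp (hpb x).1
    simpa only [mul_one_div] using ht.logHolder_self.sub h1
  obtain ⟨K₁, hK₁, hKQ⟩ := hQ.logHolder_self.exists_rpow_le
  obtain ⟨K₂, hK₂, hKα⟩ := hlogα.exists_rpow_le
  refine ⟨b, max K₁ K₂, cp, Ct, ε / Cp,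
    { b_pos := hb
      one_le_K := hK₁.trans (le_max_left _ _)
      c_pos := hcp
      a_pos := by positivity
      measure_ball := hball
      le_p := fun x => (hpb x).1
      t_pos := ht.bdd.pos
      t_le := fun x => (htb x).2
      le_smoothness := fun x => ?_
      rpow_Q := fun x y r hr hr1 hd => (hKQ x y r hr hr1 hd).trans ?_
      rpow_smoothness := fun x y r hr hr1 hd => (hKα x y r hr hr1 hd).trans ?_ }⟩
  · have hpx := hp.bdd.pos x
    have e : t x - Q x / p x = (t x * p x - Q x) / p x := by field_simp
    rw [e]
    exact div_le_div₀ (hε.le.trans (hε' x)) (hε' x) hpx (hpb x).2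
  · gcongr; exact le_max_left _ _
  · gcongr; exact le_max_right _ _

/-- A scalar Hajłasz gradient of variable smoothness. -/
def IsHajlaszGradient (μ : Measure X) (t : X → ℝ) (u : X → EReal) (g : X → ℝ≥0∞) : Prop :=
  Measurable g ∧ ∃ N : Set X, μ N = 0 ∧ ∀ x y : X, x ∉ N → y ∉ N → x ≠ y →
    (u x - u y).abs ≤ edist x y ^ t x * g x + edist x y ^ t y * g y

/-- Infinite values become `0` under `toReal`, so passing to real functions only lowers the modular.
-/
lemma ofReal_abs_toReal_le (z : EReal) : ENNReal.ofReal |z.toReal| ≤ z.abs := by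
  induction z with
  | bot => simp
  | top => simp
  | coe a => rw [EReal.toReal_coe, EReal.abs_def]

lemma ofReal_toReal_div_rpow_le {L q : ℝ} (hL : 0 < L) (hq : 0 ≤ q) {v : ℝ} {w : ℝ≥0∞}
    (hv : 0 ≤ v) (h : ENNReal.ofReal v ≤ w) :
    ENNReal.ofReal ((v / L) ^ q) ≤ (w / ENNReal.ofReal L) ^ q := by
  rw [← ENNReal.ofReal_rpow_of_nonneg (by positivity) hq, ENNReal.ofReal_div_of_pos hL]
  gcongr

/-- A function with a Hajłasz gradient is, off a null set, bounded and Hölder continuous, with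
the bounds depending linearly on the norms. -/
lemma AdmissibleData.exists_holder_bound [BorelSpace X] {b K c S a : ℝ}
    (H : AdmissibleData μ Q t p b K c S a) (hp : Measurable p) :
    ∃ C : ℝ, 0 < C ∧ ∀ (u : X → EReal) (g : X → ℝ≥0∞) (L : ℝ), 0 < L → Measurable u →
      (∀ᵐ x ∂μ, u x ≠ ⊤ ∧ u x ≠ ⊥) → IsHajlaszGradient μ t u g →
      modular μ (fun x => ENNReal.ofReal (p x)) (fun x => (u x).abs / ENNReal.ofReal L) ≤ 1 →
      modular μ (fun x => ENNReal.ofReal (p x)) (fun x => g x / ENNReal.ofReal L) ≤ 1 →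
      ∃ N : Set X, μ N = 0 ∧ (∀ x, x ∉ N → u x = ((u x).toReal : EReal)) ∧
        (∀ x, x ∉ N → |(u x).toReal| ≤ C * L) ∧
        ∀ x y, x ∉ N → y ∉ N →
          |(u x).toReal - (u y).toReal| ≤ C * L * dist x y ^ (t x - Q x / p x) := by
  have hp0 : ∀ x, 0 < p x := fun x => H.c_pos.trans_le (H.le_p x)
  obtain ⟨C, hC, hmain⟩ := H.exists_pointwise_bound
  refine ⟨C + 1, by linarith, fun u g L hL hu hfin ⟨hgm, N₀, hN₀, hgrad⟩ hmu hmg => ?_⟩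
  rw [modular_ofReal hp0] at hmu hmg
  -- A finite modular forces `g` to be finite almost everywhere; the remaining points join the
  -- exceptional set.
  have hgfin : ∀ᵐ x ∂μ, g x ≠ ∞ := by
    have h1 : Measurable fun x => (g x / ENNReal.ofReal L) ^ p x :=
      (hgm.div_const _).pow hp
    filter_upwards [ae_lt_top h1 (hmg.trans_lt ENNReal.one_lt_top).ne] with x hx h
    rw [h, ENNReal.top_div_of_ne_top ENNReal.ofReal_ne_top, ENNReal.top_rpow_of_pos (hp0 x)] at hx
    exact lt_irrefl _ hx
  have hall : ∀ᵐ x ∂μ, x ∉ N₀ ∧ (u x ≠ ⊤ ∧ u x ≠ ⊥) ∧ g x ≠ ∞ := by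
    filter_upwards [measure_eq_zero_iff_ae_notMem.1 hN₀, hfin, hgfin] with x h1 h2 h3
    exact ⟨h1, h2, h3⟩
  set N : Set X := {x | ¬ (x ∉ N₀ ∧ (u x ≠ ⊤ ∧ u x ≠ ⊥) ∧ g x ≠ ∞)} with hNdef
  have hN : μ N = 0 := ae_iff.1 hall
  have hmem : ∀ x, x ∉ N → x ∉ N₀ ∧ (u x ≠ ⊤ ∧ u x ≠ ⊥) ∧ g x ≠ ∞ := fun x hx => by
    simpa only [hNdef, mem_ofPred_eq, not_not] using hx
  have hcoe : ∀ x, x ∉ N → u x = ((u x).toReal : EReal) := fun x hx =>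
    (EReal.coe_toReal (hmem x hx).2.1.1 (hmem x hx).2.1.2).symm
  have hint : ∫⁻ x, ENNReal.ofReal (((g x).toReal / L) ^ p x + |(u x).toReal / L| ^ p x) ∂μ
      ≤ 2 := by
    calc _ ≤ ∫⁻ x, ((g x / ENNReal.ofReal L) ^ p x + ((u x).abs / ENNReal.ofReal L) ^ p x) ∂μ := by
          refine lintegral_mono fun x => ?_
          rw [ENNReal.ofReal_add (by positivity) (by positivity), abs_div, abs_of_pos hL]
          exact add_le_add
            (ofReal_toReal_div_rpow_le hL (hp0 x).le ENNReal.toReal_nonneg ENNReal.ofReal_toReal_le)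
            (ofReal_toReal_div_rpow_le hL (hp0 x).le (abs_nonneg _) (ofReal_abs_toReal_le _))
      _ ≤ 1 + 1 := by
          rw [lintegral_add_left ((hgm.div_const _).pow hp)]
          exact add_le_add hmg hmu
      _ = 2 := one_add_one_eq_two
  have hgrad' : ∀ x y, x ∉ N → y ∉ N → |(u x).toReal / L - (u y).toReal / L| ≤
      dist x y ^ t x * ((g x).toReal / L) + dist x y ^ t y * ((g y).toReal / L) := by
    intro x y hx hy
    rcases eq_or_ne x y with rfl | hxy
    · simp only [sub_self, abs_zero]; positivity
    have h1 := hgrad x y (hmem x hx).1 (hmem y hy).1 hxy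
    rw [hcoe x hx, hcoe y hy, ← EReal.coe_sub, EReal.abs_def, edist_dist,
      ENNReal.ofReal_rpow_of_nonneg dist_nonneg (H.t_pos x).le,
      ENNReal.ofReal_rpow_of_nonneg dist_nonneg (H.t_pos y).le,
      ← ENNReal.ofReal_toReal (hmem x hx).2.2, ← ENNReal.ofReal_toReal (hmem y hy).2.2,
      ← ENNReal.ofReal_mul (by positivity), ← ENNReal.ofReal_mul (by positivity),
      ← ENNReal.ofReal_add (by positivity) (by positivity),
      ENNReal.ofReal_le_ofReal_iff (by positivity)] at h1
    rw [← sub_div, abs_div, abs_of_pos hL, ← mul_div_assoc, ← mul_div_assoc, ← add_div]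
    exact div_le_div_of_nonneg_right h1 hL.le
  obtain ⟨h1, h2⟩ := hmain N (fun x => (u x).toReal / L) (fun x => (g x).toReal / L) hN
    (fun x => by positivity) hint hgrad'
  refine ⟨N, hN, hcoe, fun x hx => ?_, fun x y hx hy => ?_⟩
  · have h3 := h1 x hx
    rw [abs_div, abs_of_pos hL, div_le_iff₀ hL] at h3
    linarith
  · have h3 := h2 x y hx hy
    rw [← sub_div, abs_div, abs_of_pos hL, div_le_iff₀ hL] at h3
    have h4 : 0 ≤ L * dist x y ^ (t x - Q x / p x) := by positivity
    linarith

end Hajlasz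

/-! ### Hölder functions: extension, closure and compactness -/

/-- For `d ≤ 1` one has `d ^ α x ≤ d ^ a`, so a single modulus of continuity serves all points
despite the variable exponent. -/
lemma exists_modulus {ι : Type*} {α : ι → ℝ} {a M : ℝ} (ha : 0 < a)
    (hα : ∀ x, a ≤ α x) (hM : 0 ≤ M) {ε : ℝ} (hε : 0 < ε) :
    ∃ δ : ℝ, 0 < δ ∧ δ ≤ 1 ∧ ∀ (x : ι) (d : ℝ), 0 ≤ d → d ≤ δ → M * d ^ α x < ε := by
  have h : Tendsto (fun d : ℝ => M * d ^ a) (𝓝 0) (𝓝 0) := by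
    have h1 := ((continuous_id.tendsto (0 : ℝ)).rpow_const (p := a) (Or.inr ha.le)).const_mul M
    simpa [Real.zero_rpow ha.ne'] using h1
  obtain ⟨δ, hδ, hball⟩ := Metric.eventually_nhds_iff.1 (h.eventually (gt_mem_nhds hε))
  refine ⟨min (δ / 2) 1, by positivity, min_le_right _ _, fun x d hd0 hd => ?_⟩
  have hd1 : d ≤ 1 := hd.trans (min_le_right _ _)
  have hd2 : d ≤ δ / 2 := hd.trans (min_le_left _ _)
  refine lt_of_le_of_lt ?_ (hball (y := d) ?_)
  · exact mul_le_mul_of_nonneg_left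
      (Real.rpow_le_rpow_of_exponent_ge' hd0 hd1 ha.le (hα x)) hM
  · rw [Real.dist_eq, sub_zero, abs_of_nonneg hd0]; linarith

section HolderCompact

variable {X : Type*} [MetricSpace X] {α lam : X → ℝ} {a A M : ℝ}

lemma uniformContinuous_of_holder (ha : 0 < a) (hα : ∀ x, a ≤ α x) (hM : 0 ≤ M) {D : Set X}
    {f : X → ℝ} (h : ∀ x y, x ∈ D → y ∈ D → |f x - f y| ≤ M * dist x y ^ α x) :
    UniformContinuous (D.domRestrict f) := by
  rw [Metric.uniformContinuous_iff]
  intro ε hε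
  obtain ⟨δ, hδ, -, hmod⟩ := exists_modulus ha hα hM hε
  refine ⟨δ, hδ, fun x y hxy => ?_⟩
  rw [Real.dist_eq]
  exact (h x y x.2 y.2).trans_lt (hmod x _ dist_nonneg (le_of_lt hxy))

lemma exists_continuous_extension (ha : 0 < a) (hα : ∀ x, a ≤ α x) (hM : 0 ≤ M) {D : Set X}
    (hD : Dense D) {f : X → ℝ}
    (h : ∀ x y, x ∈ D → y ∈ D → |f x - f y| ≤ M * dist x y ^ α x) :
    ∃ v : X → ℝ, Continuous v ∧ ∀ x ∈ D, v x = f x := by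
  have hu := uniformContinuous_of_holder ha hα hM h
  exact ⟨hD.extend (D.domRestrict f), (hD.uniformContinuous_extend hu).continuous,
    fun x hx => hD.extend_of_ind hu ⟨x, hx⟩⟩

/-- The inequality is a closed condition on `X × X`. Positivity of `α` gives continuity of the power
on the diagonal, where the base vanishes. -/
lemma holder_of_dense (hαc : Continuous α) (hα0 : ∀ x, 0 < α x) {D : Set X}
    (hD : Dense D) {v : X → ℝ} (hv : Continuous v)
    (h : ∀ x y, x ∈ D → y ∈ D → |v x - v y| ≤ M * dist x y ^ α x) (x y : X) :
    |v x - v y| ≤ M * dist x y ^ α x := by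
  have hc : IsClosed {z : X × X | |v z.1 - v z.2| ≤ M * dist z.1 z.2 ^ α z.1} := by
    refine isClosed_le (by fun_prop) (continuous_const.mul ?_)
    exact (continuous_fst.dist continuous_snd).rpow (hαc.comp continuous_fst)
      fun z => Or.inr (hα0 z.1)
  have hsub : D ×ˢ D ⊆ {z : X × X | |v z.1 - v z.2| ≤ M * dist z.1 z.2 ^ α z.1} :=
    fun z hz => h z.1 z.2 hz.1 hz.2
  exact closure_minimal hsub hc (hD.prod hD (x, y))

lemma abs_le_of_dense {D : Set X} (hD : Dense D) {v : X → ℝ} (hv : Continuous v)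
    (h : ∀ x, x ∈ D → |v x| ≤ M) (x : X) : |v x| ≤ M :=
  closure_minimal (fun z hz => h z hz) (isClosed_le hv.abs continuous_const) (hD x)

lemma holderSeminorm_le {B : ℝ} {v : X → ℝ}
    (h : ∀ x y, x ≠ y → |v x - v y| ≤ B * dist x y ^ lam x) :
    holderSeminorm lam v ≤ ENNReal.ofReal B := by
  refine iSup_le fun x => iSup_le fun y => iSup_le fun hxy => ?_
  have hd : 0 < dist x y := dist_pos.2 hxy
  have hdl : 0 < dist x y ^ lam x := Real.rpow_pos_of_pos hd _
  rw [edist_dist, ENNReal.ofReal_rpow_of_pos hd, ← ofReal_norm,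
    ← ENNReal.ofReal_div_of_pos hdl, Real.norm_eq_abs]
  exact ENNReal.ofReal_le_ofReal ((div_le_iff₀ hdl).2 (h x y hxy))

lemma holderNorm_le {B : ℝ} {v : X → ℝ} (hM : 0 ≤ M) (hB : 0 ≤ B) (h0 : ∀ x, |v x| ≤ M)
    (h : ∀ x y, x ≠ y → |v x - v y| ≤ B * dist x y ^ lam x) :
    holderNorm lam v ≤ ENNReal.ofReal (M + B) := by
  rw [ENNReal.ofReal_add hM hB]
  refine add_le_add (iSup_le fun x => ?_) (holderSeminorm_le h)
  rw [← ofReal_norm, Real.norm_eq_abs]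
  exact ENNReal.ofReal_le_ofReal (h0 x)

/-- Lowering the Hölder exponent of a bounded function. -/
lemma holder_mono (hM : 0 ≤ M) (hlam : ∀ x, 0 < lam x) (hle : ∀ x, lam x ≤ α x) {v : X → ℝ}
    (h0 : ∀ x, |v x| ≤ M) (h : ∀ x y, |v x - v y| ≤ M * dist x y ^ α x) (x y : X) :
    |v x - v y| ≤ 2 * M * dist x y ^ lam x := by
  rcases le_total (dist x y) 1 with hd | hd
  · have h1 := Real.rpow_le_rpow_of_exponent_ge' dist_nonneg hd (hlam x).le (hle x)
    have h2 : M * dist x y ^ α x ≤ M * dist x y ^ lam x := by gcongr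
    have h3 : 0 ≤ M * dist x y ^ lam x := by positivity
    linarith [h x y]
  · have h1 : 1 ≤ dist x y ^ lam x := Real.one_le_rpow hd (hlam x).le
    have h2 : |v x - v y| ≤ 2 * M := by
      have := abs_sub (v x) (v y)
      linarith [h0 x, h0 y]
    exact h2.trans (le_mul_of_one_le_right (by positivity) h1)

lemma separableSpace_of_totallyBounded (hX : TotallyBounded (univ : Set X)) :
    TopologicalSpace.SeparableSpace X := by
  have : SecondCountableTopology X := by
    refine Metric.secondCountable_of_almost_dense_set fun ε hε => ?_
    obtain ⟨t, ht, hcov⟩ := Metric.totallyBounded_iff.1 hX ε hε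
    refine ⟨t, ht.countable, fun x => ?_⟩
    obtain ⟨y, hy, hxy⟩ := mem_iUnion₂.1 (hcov (mem_univ x))
    exact ⟨y, hy, (Metric.mem_ball.1 hxy).le⟩
  infer_instance

/-- An Arzelà–Ascoli theorem on a totally bounded space. -/
lemma exists_uniform_limit (hX : TotallyBounded (univ : Set X)) (ha : 0 < a)
    (hα : ∀ x, a ≤ α x) (hM : 0 ≤ M) {v : ℕ → X → ℝ} (h0 : ∀ n x, |v n x| ≤ M)
    (h : ∀ n x y, |v n x - v n y| ≤ M * dist x y ^ α x) :
    ∃ (w : X → ℝ) (φ : ℕ → ℕ), StrictMono φ ∧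
      TendstoUniformlyOn (fun n => v (φ n)) w atTop univ := by
  rcases isEmpty_or_nonempty X with hE | hE
  · refine ⟨fun _ => 0, id, strictMono_id, ?_⟩
    rw [univ_eq_empty_iff.2 hE]
    exact tendstoUniformlyOn_empty
  have := separableSpace_of_totallyBounded hX
  set e := TopologicalSpace.denseSeq X with he
  -- Tychonoff replaces the diagonal argument: the values on a dense sequence form points of a
  -- compact, metrizable product.
  have hK : IsCompact (Set.pi univ fun _ : ℕ => Icc (-M) M) :=
    isCompact_univ_pi fun _ => isCompact_Icc
  obtain ⟨z, -, φ, hφ, hz⟩ := hK.tendsto_subseq (x := fun n k => v n (e k))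
    (fun n k _ => abs_le.1 (h0 n (e k)))
  rw [tendsto_pi_nhds] at hz
  have hcauchy : UniformCauchySeqOn (fun n => v (φ n)) atTop univ := by
    rw [Metric.uniformCauchySeqOn_iff]
    intro ε hε
    obtain ⟨δ, hδ, -, hmod⟩ := exists_modulus ha hα hM (show 0 < ε / 3 by positivity)
    obtain ⟨T, hT, hcov⟩ := Metric.totallyBounded_iff.1 hX (δ / 2) (by positivity)
    have hnear : ∀ x : X, ∃ k, dist x (e k) < δ / 2 := fun x =>
      (TopologicalSpace.denseRange_denseSeq X).exists_dist_lt x (by positivity)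
    choose κ hκ using hnear
    -- Each centre `y` of the finite net is replaced by the dense-sequence point `e (κ y)`, where
    -- convergence is known. The errors add up to `2 * (ε / 3) + 2 * (ε / 6) = ε`.
    have hev : ∀ᶠ n in atTop, ∀ y ∈ T, |v (φ n) (e (κ y)) - z (κ y)| < ε / 6 := by
      refine (eventually_all_finite hT).2 fun y _ => ?_
      have := (hz (κ y)).eventually (Metric.ball_mem_nhds _ (show 0 < ε / 6 by positivity))
      filter_upwards [this] with n hn
      rwa [Real.dist_eq] at hn
    obtain ⟨n₀, hn₀⟩ := eventually_atTop.1 hev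
    refine ⟨n₀, fun m hm n hn x _ => ?_⟩
    obtain ⟨y, hy, hxy⟩ := mem_iUnion₂.1 (hcov (mem_univ x))
    have hd : dist x (e (κ y)) ≤ δ := by
      have h1 := dist_triangle x y (e (κ y))
      linarith [Metric.mem_ball.1 hxy, hκ y]
    have hm1 := abs_lt.1 ((h (φ m) x (e (κ y))).trans_lt (hmod x _ dist_nonneg hd))
    have hn1 := abs_lt.1 ((h (φ n) x (e (κ y))).trans_lt (hmod x _ dist_nonneg hd))
    have hm2 := abs_lt.1 (hn₀ m hm y hy)
    have hn2 := abs_lt.1 (hn₀ n hn y hy)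
    rw [Real.dist_eq, abs_lt]
    constructor <;> linarith [hm1.1, hm1.2, hn1.1, hn1.2, hm2.1, hm2.2, hn2.1, hn2.2]
  have hpt : ∀ x, ∃ l, Tendsto (fun n => v (φ n) x) atTop (𝓝 l) := fun x =>
    cauchySeq_tendsto_of_complete (hcauchy.cauchySeq (mem_univ x))
  choose w hw using hpt
  exact ⟨w, φ, hφ, hcauchy.tendstoUniformlyOn_of_tendsto fun x _ => hw x⟩

/-- Interpolation: uniform convergence of a sequence bounded in a Hölder class implies
convergence in every Hölder class of smaller exponent. -/
lemma tendsto_holderNorm (hM : 0 ≤ M) (hA : ∀ x, α x ≤ A) (hlam : ∀ x, 0 < lam x)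
    (hgap : UnifLL lam α) {D : ℕ → X → ℝ}
    (h : ∀ n x y, |D n x - D n y| ≤ M * dist x y ^ α x)
    (hunif : ∀ ε > 0, ∀ᶠ n in atTop, ∀ x, |D n x| ≤ ε) :
    Tendsto (fun n => holderNorm lam (D n)) atTop (𝓝 0) := by
  obtain ⟨c, hc, hgap⟩ := hgap
  rw [ENNReal.tendsto_nhds_zero]
  intro ε' hε'
  obtain ⟨ε, hε, hεε'⟩ : ∃ ε : ℝ, 0 < ε ∧ ENNReal.ofReal ε ≤ ε' := by
    obtain ⟨r, hr0, hr⟩ := ENNReal.lt_iff_exists_nnreal_btwn.1 hε'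
    exact ⟨r, by exact_mod_cast hr0, by simpa using hr.le⟩
  obtain ⟨δ, hδ, hδ1, hmod⟩ := exists_modulus (α := fun _ : X => c) hc (fun _ => le_rfl) hM
    (show 0 < ε / 2 by positivity)
  have hδA : 0 < δ ^ A := Real.rpow_pos_of_pos hδ A
  -- The first bound serves the sup norm. The second serves pairs with `d ≥ δ`, where `d ^ lam x ≥ δ
  -- ^ A`; closer pairs gain the factor `d ^ c` from the gap.
  set η : ℝ := min (ε / 2) (ε / 4 * δ ^ A) with hη
  have hη0 : 0 < η := by positivity
  filter_upwards [hunif η hη0] with n hn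
  refine le_trans ?_ hεε'
  have e : ε = ε / 2 + ε / 2 := by ring
  rw [e]
  refine holderNorm_le (by positivity) (by positivity)
    (fun x => (hn x).trans (min_le_left _ _)) fun x y hxy => ?_
  have hd : 0 < dist x y := dist_pos.2 hxy
  rcases le_total (dist x y) δ with hdδ | hdδ
  · have h1 : dist x y ^ α x ≤ dist x y ^ c * dist x y ^ lam x := by
      rw [← Real.rpow_add hd]
      exact Real.rpow_le_rpow_of_exponent_ge hd (hdδ.trans hδ1) (by linarith [hgap x])
    calc |D n x - D n y| ≤ M * dist x y ^ α x := h n x y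
      _ ≤ M * (dist x y ^ c * dist x y ^ lam x) := by gcongr
      _ = (M * dist x y ^ c) * dist x y ^ lam x := by ring
      _ ≤ ε / 2 * dist x y ^ lam x := by
        gcongr
        exact (hmod x _ dist_nonneg hdδ).le
  · have h1 : δ ^ A ≤ dist x y ^ lam x :=
      calc δ ^ A ≤ δ ^ lam x :=
            Real.rpow_le_rpow_of_exponent_ge hδ hδ1 (by linarith [hgap x, hA x])
        _ ≤ _ := Real.rpow_le_rpow hδ.le hdδ (hlam x).le
    calc |D n x - D n y| ≤ |D n x| + |D n y| := abs_sub _ _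
      _ ≤ ε / 4 * δ ^ A + ε / 4 * δ ^ A :=
        add_le_add ((hn x).trans (min_le_right _ _)) ((hn y).trans (min_le_right _ _))
      _ = ε / 2 * δ ^ A := by ring
      _ ≤ _ := by gcongr

end HolderCompact

/-! ### From almost everywhere bounds to compact embeddings -/

section Embedding

variable {X : Type*} [MetricSpace X] [MeasurableSpace X] {μ : Measure X} {α lam : X → ℝ}
  {a A C : ℝ}

/-- Linear a.e. Hölder bounds with a larger exponent imply a compact embedding. -/
theorem compactEmbedsHolder_of_ae_bound [μ.IsOpenPosMeasure]
    (hX : TotallyBounded (univ : Set X)) (hαc : Continuous α) (ha : 0 < a) (hα : ∀ x, a ≤ α x)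
    (hA : ∀ x, α x ≤ A) (hlam : ∀ x, 0 < lam x) (hgap : UnifLL lam α) (hC : 0 < C)
    {mem : (X → EReal) → Prop} {nrm : (X → EReal) → ℝ≥0∞} (hfin : ∀ u, mem u → nrm u < ∞)
    (hbd : ∀ (u : X → EReal) (L : ℝ), mem u → 0 < L → nrm u < ENNReal.ofReal L →
      ∃ N : Set X, μ N = 0 ∧ (∀ x, x ∉ N → u x = ((u x).toReal : EReal)) ∧
        (∀ x, x ∉ N → |(u x).toReal| ≤ C * L) ∧
        ∀ x y, x ∉ N → y ∉ N → |(u x).toReal - (u y).toReal| ≤ C * L * dist x y ^ α x) :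
    CompactEmbedsHolder μ mem nrm lam := by
  have hα0 : ∀ x, 0 < α x := fun x => ha.trans_le (hα x)
  have hle : ∀ x, lam x ≤ α x := fun x => by
    obtain ⟨c, hc, h⟩ := hgap
    linarith [h x]
  have hlevel : ∀ u, mem u → ∃ L : ℝ, 0 < L ∧ nrm u < ENNReal.ofReal L := fun u hu => by
    obtain ⟨r, hr⟩ := ENNReal.lt_iff_exists_nnreal_btwn.1 (hfin u hu)
    have h0 : (0 : ℝ≥0∞) < r := hr.1.bot_lt
    exact ⟨r, by exact_mod_cast h0, by simpa using hr.1⟩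
  -- Any continuous representative agrees with `u` off `N` on a dense set, so it inherits the bounds
  -- everywhere with the same constants.
  have hcont : ∀ (u : X → EReal) (v : X → ℝ) (L : ℝ), mem u → 0 < L → nrm u < ENNReal.ofReal L →
      Continuous v → IsRep μ u v →
      (∀ x, |v x| ≤ C * L) ∧ ∀ x y, |v x - v y| ≤ C * L * dist x y ^ α x := by
    intro u v L hu hL hn hv hrep
    obtain ⟨N, hN, -, hsup, hhol⟩ := hbd u L hu hL hn
    have hae : ∀ᵐ x ∂μ, x ∉ N ∧ u x = ((v x : ℝ) : EReal) :=
      (measure_eq_zero_iff_ae_notMem.1 hN).and hrep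
    have hD : Dense {x | x ∉ N ∧ u x = ((v x : ℝ) : EReal)} := Measure.dense_of_ae hae
    have hval : ∀ x, u x = ((v x : ℝ) : EReal) → (u x).toReal = v x := fun x hx => by
      rw [hx, EReal.toReal_coe]
    refine ⟨abs_le_of_dense hD hv fun x hx => ?_, holder_of_dense hαc hα0 hD hv
      fun x y hx hy => ?_⟩
    · rw [← hval x hx.2]; exact hsup x hx.1
    · rw [← hval x hx.2, ← hval y hy.2]; exact hhol x y hx.1 hy.1
  have hnorm : ∀ (u : X → EReal) (v : X → ℝ) (L : ℝ), mem u → 0 < L →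
      nrm u < ENNReal.ofReal L → Continuous v → IsRep μ u v →
      holderNorm lam v ≤ ENNReal.ofReal (3 * C * L) := by
    intro u v L hu hL hn hv hrep
    obtain ⟨h0, h1⟩ := hcont u v L hu hL hn hv hrep
    have hM : 0 ≤ C * L := by positivity
    refine (holderNorm_le hM (B := 2 * (C * L)) (by positivity) h0
      fun x y _ => holder_mono hM hlam hle h0 h1 x y).trans_eq ?_
    congr 1; ring
  have hmemH : ∀ v : X → ℝ, Continuous v → holderNorm lam v < ∞ → MemHolderVar lam v :=
    fun v hv h => ⟨hv, (ENNReal.add_lt_top.1 h).1, (ENNReal.add_lt_top.1 h).2⟩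
  refine ⟨fun u hu => ?_, ?_, ?_⟩
  · obtain ⟨L, hL, hn⟩ := hlevel u hu
    obtain ⟨N, hN, hcoe, hsup, hhol⟩ := hbd u L hu hL hn
    have hN' : ∀ᵐ x ∂μ, x ∈ Nᶜ := measure_eq_zero_iff_ae_notMem.1 hN
    obtain ⟨v, hv, hveq⟩ := exists_continuous_extension ha hα (by positivity)
      (Measure.dense_of_ae hN') hhol
    have hrep : IsRep μ u v := by
      filter_upwards [hN'] with x hx
      rw [hveq x hx]; exact hcoe x hx
    refine ⟨v, ⟨hmemH v hv ((hnorm u v L hu hL hn hv hrep).trans_lt ENNReal.ofReal_lt_top), hrep⟩,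
      fun v' hv' => ?_⟩
    refine (Continuous.ae_eq_iff_eq μ hv'.1.1 hv).1 ?_
    filter_upwards [hv'.2, hrep] with x h1 h2
    exact_mod_cast h1.symm.trans h2
  · refine ⟨(3 * C).toNNReal, fun u v hu hv hrep => ?_⟩
    change holderNorm lam v ≤ ENNReal.ofReal (3 * C) * nrm u
    refine ENNReal.le_of_forall_pos_le_add fun ε hε _ => ?_
    -- The bounds need a level strictly above the norm, which may be zero; the excess contributes
    -- exactly `ε` after multiplication by `3 * C`.
    set L : ℝ := (nrm u).toReal + ε / (3 * C) with hLdef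
    have hL : 0 < L := by positivity
    have hnu : nrm u = ENNReal.ofReal (nrm u).toReal := (ENNReal.ofReal_toReal (hfin u hu).ne).symm
    have hn : nrm u < ENNReal.ofReal L := by
      rw [hnu, ENNReal.ofReal_lt_ofReal_iff hL]
      have : (0 : ℝ) < ε / (3 * C) := by positivity
      linarith
    refine (hnorm u v L hu hL hn hv.1 hrep).trans_eq ?_
    rw [hLdef, mul_add, mul_div_cancel₀ _ (by positivity),
      ENNReal.ofReal_add (by positivity) (by positivity), ENNReal.ofReal_mul (by positivity),
      ← hnu, ENNReal.ofReal_coe_nnreal]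
  · intro u v hu ⟨B, hB⟩ hv hrep
    set L : ℝ := B + 1 with hLdef
    have hL : 0 < L := by positivity
    have hn : ∀ n, nrm (u n) < ENNReal.ofReal L := fun n => by
      refine (hB n).trans_lt ?_
      rw [← ENNReal.ofReal_coe_nnreal, ENNReal.ofReal_lt_ofReal_iff hL]
      linarith
    have hM : 0 ≤ C * L := by positivity
    have hb := fun n => hcont (u n) (v n) L (hu n) hL (hn n) (hv n).1 (hrep n)
    obtain ⟨w, φ, hφ, hunif⟩ := exists_uniform_limit hX ha hα hM (fun n => (hb n).1)
      (fun n => (hb n).2)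
    have hpt : ∀ x, Tendsto (fun n => v (φ n) x) atTop (𝓝 (w x)) := fun x =>
      hunif.tendsto_at (mem_univ x)
    have hw0 : ∀ x, |w x| ≤ C * L := fun x =>
      le_of_tendsto (hpt x).abs (Eventually.of_forall fun n => (hb (φ n)).1 x)
    have hw1 : ∀ x y, |w x - w y| ≤ C * L * dist x y ^ α x := fun x y =>
      le_of_tendsto ((hpt x).sub (hpt y)).abs (Eventually.of_forall fun n => (hb (φ n)).2 x y)
    have hwc : Continuous w := by
      rw [← continuousOn_univ]
      exact hunif.continuousOn (Frequently.of_forall fun n => (hv (φ n)).1.continuousOn)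
    refine ⟨w, φ, hmemH w hwc ?_, hφ, ?_⟩
    · exact (holderNorm_le hM (B := 2 * (C * L)) (by positivity) hw0
        fun x y _ => holder_mono hM hlam hle hw0 hw1 x y).trans_lt ENNReal.ofReal_lt_top
    · refine tendsto_holderNorm (M := 2 * (C * L)) (by positivity) hA hlam hgap
        (fun n x y => ?_) fun ε hε => ?_
      · calc |v (φ n) x - w x - (v (φ n) y - w y)|
            = |(v (φ n) x - v (φ n) y) - (w x - w y)| := by ring_nf
          _ ≤ |v (φ n) x - v (φ n) y| + |w x - w y| := abs_sub _ _
          _ ≤ C * L * dist x y ^ α x + C * L * dist x y ^ α x :=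
            add_le_add ((hb (φ n)).2 x y) (hw1 x y)
          _ = _ := by ring
      · filter_upwards [Metric.tendstoUniformlyOn_iff.1 hunif ε hε] with n hn x
        have := hn x (mem_univ x)
        rw [dist_comm, Real.dist_eq] at this
        exact this.le

end Embedding

/-! ### Modulars -/

section Modular

variable {X : Type*} [MeasurableSpace X] {μ : Measure X} {p : X → ℝ} {c : ℝ}

lemma modular_mono (hp : ∀ x, 0 < p x) {f g : X → ℝ≥0∞} (h : ∀ x, f x ≤ g x) :
    modular μ (fun x => ENNReal.ofReal (p x)) f ≤ modular μ (fun x => ENNReal.ofReal (p x)) g := by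
  rw [modular_ofReal hp, modular_ofReal hp]
  exact lintegral_mono fun x => ENNReal.rpow_le_rpow (h x) (hp x).le

lemma modular_div_le_one_of_lpNorm_lt (hp : ∀ x, 0 < p x) {f : X → ℝ≥0∞} {M : ℝ≥0∞}
    (h : lpNorm μ (fun x => ENNReal.ofReal (p x)) f < M) :
    modular μ (fun x => ENNReal.ofReal (p x)) (fun x => f x / M) ≤ 1 := by
  obtain ⟨l, ⟨-, -, hl⟩, hlM⟩ := sInf_lt_iff.1 h
  exact (modular_mono hp fun x => ENNReal.div_le_div_left hlM.le _).trans hl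

/-- A finite modular becomes at most one after rescaling. -/
lemma modular_div_le_one (hc : 0 < c) (hp : ∀ x, c ≤ p x) {f : X → ℝ≥0∞} {K : ℝ} (hK : 1 ≤ K)
    (h : modular μ (fun x => ENNReal.ofReal (p x)) f ≤ ENNReal.ofReal K) :
    modular μ (fun x => ENNReal.ofReal (p x)) (fun x => f x / ENNReal.ofReal (K ^ (1 / c))) ≤ 1 := by
  have hp0 : ∀ x, 0 < p x := fun x => hc.trans_le (hp x)
  have hK0 : 0 < K := by linarith
  rw [modular_ofReal hp0] at h ⊢
  -- Since `K ≥ 1` and `p x ≥ c`, the scale satisfies `(K ^ (1 / c)) ^ p x ≥ K`.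
  have hpt : ∀ x, (f x / ENNReal.ofReal (K ^ (1 / c))) ^ p x ≤
      (ENNReal.ofReal K)⁻¹ * f x ^ p x := fun x => by
    rw [ENNReal.div_rpow_of_nonneg _ _ (hp0 x).le, ENNReal.div_eq_inv_mul]
    gcongr
    rw [ENNReal.ofReal_rpow_of_pos (by positivity), ← Real.rpow_mul hK0.le]
    refine ENNReal.ofReal_le_ofReal ?_
    calc K = K ^ (1 : ℝ) := (Real.rpow_one K).symm
      _ ≤ _ := by
        apply Real.rpow_le_rpow_of_exponent_le hK
        rw [one_div_mul_eq_div, one_le_div hc]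
        exact hp x
  calc _ ≤ ∫⁻ x, (ENNReal.ofReal K)⁻¹ * f x ^ p x ∂μ := lintegral_mono hpt
    _ = (ENNReal.ofReal K)⁻¹ * ∫⁻ x, f x ^ p x ∂μ :=
      lintegral_const_mul' _ _ (ENNReal.inv_ne_top.2 (by simpa using hK0))
    _ ≤ (ENNReal.ofReal K)⁻¹ * ENNReal.ofReal K := by gcongr
    _ = 1 := ENNReal.inv_mul_cancel (by simpa using hK0) ENNReal.ofReal_ne_top

lemma lpNorm_lt_top (hc : 0 < c) (hp : ∀ x, c ≤ p x) {u : X → EReal}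
    (hu : MemLpVar μ (fun x => ENNReal.ofReal (p x)) u) :
    lpNorm μ (fun x => ENNReal.ofReal (p x)) (fun x => (u x).abs) < ∞ := by
  obtain ⟨-, l, hl0, hltop, hl⟩ := hu
  set M := modular μ (fun x => ENNReal.ofReal (p x)) (fun x => l * (u x).abs) with hM
  set K : ℝ := max 1 M.toReal with hK
  have h1 := modular_div_le_one (K := K) hc hp (le_max_left _ _)
    ((ENNReal.ofReal_toReal hl.ne).symm.le.trans (ENNReal.ofReal_le_ofReal (le_max_right _ _)))
  have hk : 0 < ENNReal.ofReal (K ^ (1 / c)) := by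
    have : 0 < K := one_pos.trans_le (le_max_left _ _)
    exact ENNReal.ofReal_pos.2 (by positivity)
  have hlt : ENNReal.ofReal (K ^ (1 / c)) / l < ∞ :=
    ENNReal.div_lt_top ENNReal.ofReal_ne_top hl0.ne'
  refine lt_of_le_of_lt (sInf_le ⟨ENNReal.div_pos hk.ne' hltop.ne, hlt, ?_⟩) hlt
  convert h1 using 3 with x
  rw [ENNReal.div_eq_inv_mul, ENNReal.inv_div (Or.inl hltop.ne) (Or.inl hl0.ne'),
    ENNReal.div_eq_inv_mul, ENNReal.div_eq_inv_mul, mul_assoc]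

lemma iSup_rpow_le_tsum {ι : Type*} {r : ℝ} (hr : 0 < r) (a : ι → ℝ≥0∞) :
    (⨆ k, a k) ^ r ≤ ∑' k, a k ^ r := by
  rw [← ENNReal.le_rpow_inv_iff hr]
  refine iSup_le fun k => ?_
  rw [ENNReal.le_rpow_inv_iff hr]
  exact ENNReal.le_tsum k

lemma le_seqNorm {q : ℝ≥0∞} (hq : 0 < q) (a : ℤ → ℝ≥0∞) (k : ℤ) : a k ≤ seqNorm q a := by
  unfold seqNorm
  split_ifs with h
  · exact le_iSup a k
  · rw [one_div, ENNReal.le_rpow_inv_iff (ENNReal.toReal_pos hq.ne' h)]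
    exact ENNReal.le_tsum k

/-- A power of a supremum is at most the sum of the powers for every positive exponent, so no
triangle inequality is needed when `p < 1`. -/
lemma modular_iSup_le (hp : ∀ x, 0 < p x) (hpm : Measurable p) {h : ℤ → X → ℝ≥0∞}
    (hm : ∀ k, Measurable (h k)) :
    modular μ (fun x => ENNReal.ofReal (p x)) (fun x => ⨆ k, h k x) ≤
      ∑' k, ∫⁻ x, h k x ^ p x ∂μ := by
  rw [modular_ofReal hp, ← lintegral_tsum fun k => ((hm k).pow hpm).aemeasurable]
  exact lintegral_mono fun x => iSup_rpow_le_tsum (hp x) _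

lemma IsExponent.exists_inv_le {q : X → ℝ≥0∞} (hq : IsExponent μ q) :
    ∃ B : ℝ, 0 ≤ B ∧ ∀ᵐ x ∂μ, ((q x)⁻¹).toReal ≤ B := by
  obtain ⟨c, hc, h⟩ := hq.ess_lower
  refine ⟨(c⁻¹).toReal, ENNReal.toReal_nonneg, ?_⟩
  filter_upwards [h] with x hx
  exact ENNReal.toReal_mono (ENNReal.inv_ne_top.2 hc.ne') (ENNReal.inv_le_inv.2 hx)

/-- Pointwise comparison between a function and its rescaling by an admissible level. -/
lemma rpow_eq_level_mul {l h : ℝ≥0∞} (hl0 : 0 < l) (hl : l < ∞) {e r : ℝ} (hr : 0 ≤ r) :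
    h ^ r = l ^ (e * r) * (h / l ^ e) ^ r := by
  have h1 : l ^ e ≠ 0 := (ENNReal.rpow_pos hl0 hl.ne).ne'
  have h2 : l ^ e ≠ ∞ := ENNReal.rpow_ne_top_of_ne_zero hl0.ne' hl.ne
  rw [ENNReal.rpow_mul, ← ENNReal.mul_rpow_of_nonneg _ _ hr, ENNReal.mul_div_cancel h1 h2]

/-- The level of a function in the semimodular of `ℓ^{q(·)}(L^{p(·)})`. -/
lemma lintegral_rpow_le_level (hp : ∀ x, 0 < p x) {P : ℝ} (hP : ∀ x, p x ≤ P)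
    {q : X → ℝ≥0∞} (hqp : ∀ᵐ x ∂μ, q x ≤ ENNReal.ofReal (p x)) (hq0 : ∀ x, 0 < q x)
    {B : ℝ} (hB0 : 0 ≤ B) (hB : ∀ᵐ x ∂μ, ((q x)⁻¹).toReal ≤ B) (h : X → ℝ≥0∞)
    (hle : sInf {l : ℝ≥0∞ | 0 < l ∧ l < ∞ ∧ modular μ (fun x => ENNReal.ofReal (p x))
      (fun x => h x / l ^ ((q x)⁻¹).toReal) ≤ 1} ≤ 1) :
    ∫⁻ x, h x ^ p x ∂μ ≤ ENNReal.ofReal (2 ^ (B * P)) *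
      sInf {l : ℝ≥0∞ | 0 < l ∧ l < ∞ ∧ modular μ (fun x => ENNReal.ofReal (p x))
        (fun x => h x / l ^ ((q x)⁻¹).toReal) ≤ 1} := by
  rcases isEmpty_or_nonempty X with hE | ⟨⟨x₀⟩⟩
  · rw [Measure.eq_zero_of_isEmpty μ, lintegral_zero_measure]; exact bot_le
  have hP0 : 0 ≤ P := (hp x₀).le.trans (hP x₀)
  set K : ℝ≥0∞ := ENNReal.ofReal (2 ^ (B * P)) with hK
  have hK1 : 1 ≤ K := by
    rw [hK, ← ENNReal.ofReal_one]
    exact ENNReal.ofReal_le_ofReal (Real.one_le_rpow (by norm_num) (by positivity))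
  have hK2 : (2 : ℝ≥0∞) ^ (B * P) = K := by
    rw [hK, ← ENNReal.ofReal_rpow_of_pos (by norm_num)]; norm_num
  set s := sInf {l : ℝ≥0∞ | 0 < l ∧ l < ∞ ∧ modular μ (fun x => ENNReal.ofReal (p x))
      (fun x => h x / l ^ ((q x)⁻¹).toReal) ≤ 1} with hs
  rw [mul_comm, ← ENNReal.div_le_iff (by positivity) ENNReal.ofReal_ne_top]
  refine le_of_forall_gt fun b hb => ?_
  -- The cap `2` keeps admissible levels bounded: the infimum may equal one, and levels slightly
  -- above it must be allowed.
  have hb2 : s < min b 2 := lt_min hb (hle.trans_lt ENNReal.one_lt_two)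
  obtain ⟨l, ⟨hl0, hltop, hl⟩, hlb⟩ := sInf_lt_iff.1 hb2
  refine lt_of_le_of_lt ?_ (hlb.trans_le (min_le_left _ _))
  have hl2 : l ≤ 2 := (hlb.trans_le (min_le_right _ _)).le
  rw [ENNReal.div_le_iff (by positivity) ENNReal.ofReal_ne_top]
  rw [modular_ofReal hp] at hl
  calc ∫⁻ x, h x ^ p x ∂μ ≤ ∫⁻ x, (l * K) * (h x / l ^ ((q x)⁻¹).toReal) ^ p x ∂μ := by
        refine lintegral_mono_ae ?_
        filter_upwards [hqp, hB] with x hx hxB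
        rw [rpow_eq_level_mul hl0 hltop (e := ((q x)⁻¹).toReal) (hp x).le]
        refine mul_le_mul_left ?_ _
        -- Here `q ≤ p` enters: it gives `p / q ≥ 1`, so `l ^ (p / q) ≤ l` for `l ≤ 1`. The bound is
        -- linear in the level and can be summed over `k`; for `1 ≤ l ≤ 2` the factor `2 ^ (B * P)`
        -- suffices.
        have hinv : (p x)⁻¹ ≤ ((q x)⁻¹).toReal := by
          have := ENNReal.toReal_mono (ENNReal.inv_ne_top.2 (hq0 x).ne') (ENNReal.inv_le_inv.2 hx)
          rwa [ENNReal.toReal_inv, ENNReal.toReal_ofReal (hp x).le] at this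
        have he1 : 1 ≤ ((q x)⁻¹).toReal * p x := by
          have := mul_le_mul_of_nonneg_right hinv (hp x).le
          rwa [inv_mul_cancel₀ (hp x).ne'] at this
        have he2 : ((q x)⁻¹).toReal * p x ≤ B * P := mul_le_mul hxB (hP x) (hp x).le hB0
        rcases le_total l 1 with h1 | h1
        · calc l ^ (((q x)⁻¹).toReal * p x) ≤ l ^ (1 : ℝ) :=
                ENNReal.rpow_le_rpow_of_exponent_ge h1 he1
            _ = l * 1 := by rw [ENNReal.rpow_one, mul_one]
            _ ≤ l * K := by gcongr
        · calc l ^ (((q x)⁻¹).toReal * p x) ≤ l ^ (B * P) :=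
                ENNReal.rpow_le_rpow_of_exponent_le h1 he2
            _ ≤ 2 ^ (B * P) := ENNReal.rpow_le_rpow hl2 (by positivity)
            _ = 1 * K := by rw [hK2, one_mul]
            _ ≤ l * K := by gcongr
    _ = (l * K) * ∫⁻ x, (h x / l ^ ((q x)⁻¹).toReal) ^ p x ∂μ :=
        lintegral_const_mul' _ _ (ENNReal.mul_ne_top hltop.ne ENNReal.ofReal_ne_top)
    _ ≤ (l * K) * 1 := by gcongr
    _ = l * K := mul_one _

/-- Without `q ≤ p`, only a uniform bound survives: some level below `2` is admissible, and `l ^ (1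
/ q) ≤ 2 ^ B`. Summability over `k` must come from elsewhere. -/
lemma lintegral_div_rpow_le_one (hp : ∀ x, 0 < p x)
    {q : X → ℝ≥0∞} {B : ℝ} (hB : ∀ᵐ x ∂μ, ((q x)⁻¹).toReal ≤ B) (h : X → ℝ≥0∞)
    (hle : sInf {l : ℝ≥0∞ | 0 < l ∧ l < ∞ ∧ modular μ (fun x => ENNReal.ofReal (p x))
      (fun x => h x / l ^ ((q x)⁻¹).toReal) ≤ 1} ≤ 1) :
    ∫⁻ x, (h x / 2 ^ B) ^ p x ∂μ ≤ 1 := by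
  obtain ⟨l, ⟨hl0, hltop, hl⟩, hlb⟩ := sInf_lt_iff.1 (hle.trans_lt ENNReal.one_lt_two)
  rw [modular_ofReal hp] at hl
  refine le_trans (lintegral_mono_ae ?_) hl
  filter_upwards [hB] with x hx
  refine ENNReal.rpow_le_rpow (ENNReal.div_le_div_left ?_ _) (hp x).le
  exact (ENNReal.rpow_le_rpow hlb.le ENNReal.toReal_nonneg).trans
    (ENNReal.rpow_le_rpow_of_exponent_le one_le_two hx)

end Modular

/-! ### From vector gradients to scalar gradients -/

section Gradient

variable {X : Type*} [MetricSpace X] [MeasurableSpace X] {μ : Measure X} {s t : X → ℝ}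

/-- The supremum of a suitably weighted vector `s(·)`-gradient is a scalar `t(·)`-gradient. -/
lemma IsVectorGradient.isHajlaszGradient {u : X → EReal} {g : ℤ → X → ℝ≥0∞}
    (hg : IsVectorGradient μ s u g) {w : ℤ → ℝ≥0∞}
    (hw : ∀ (k : ℤ) (x y z : X), (2 : ℝ) ^ (-k - 1) ≤ dist x y → dist x y < (2 : ℝ) ^ (-k) →
      edist x y ^ s z ≤ edist x y ^ t z * w k) :
    IsHajlaszGradient μ t u (fun x => ⨆ k, w k * g k x) := by
  obtain ⟨hm, N, hN, hgrad⟩ := hg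
  refine ⟨Measurable.iSup fun k => (hm k).const_mul _, N, hN, fun x y hx hy hxy => ?_⟩
  -- This gives `2 ^ n ≤ d < 2 ^ (n + 1)`, so the shell index is `k = -n - 1`.
  obtain ⟨n, hn1, hn2⟩ := exists_mem_Ico_zpow (dist_pos.2 hxy) (one_lt_two (α := ℝ))
  have h1 : (2 : ℝ) ^ (-(-n - 1) - 1) ≤ dist x y := by
    rwa [show -(-n - 1) - 1 = n by ring]
  have h2 : dist x y < (2 : ℝ) ^ (-(-n - 1)) := by
    rwa [show -(-n - 1) = n + 1 by ring]
  refine (hgrad (-n - 1) x y hx hy h1 h2).trans (add_le_add ?_ ?_)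
  all_goals
    refine (mul_le_mul_left (hw (-n - 1) x y _ h1 h2) _).trans ?_
    rw [mul_assoc]
    gcongr
    exact le_iSup (fun k => w k * g k _) (-n - 1)

lemma IsVectorGradient.isHajlaszGradient_iSup {u : X → EReal} {g : ℤ → X → ℝ≥0∞}
    (hg : IsVectorGradient μ s u g) : IsHajlaszGradient μ s u (fun x => ⨆ k, g k x) := by
  simpa only [one_mul] using
    hg.isHajlaszGradient (t := s) (w := fun _ => 1) fun k x y z _ _ => (mul_one _).ge

end Gradient

/-! ### Embeddings of the Hajłasz–Triebel–Lizorkin and Hajłasz–Besov spaces -/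

section Embeddings

/-- On a bounded space, the gain of smoothness in the dyadic shells decays geometrically. -/
lemma exists_weight {X : Type*} [MetricSpace X] {s t : X → ℝ} (hX : TotallyBounded (univ : Set X))
    {ε S : ℝ} (hε : 0 < ε) (hst : ∀ x, ε ≤ s x - t x) (hS : ∀ x, s x - t x ≤ S) :
    ∃ A θ : ℝ, 0 < A ∧ 0 < θ ∧ θ < 1 ∧ ∀ (k : ℤ) (x y z : X),
      (2 : ℝ) ^ (-k - 1) ≤ dist x y → dist x y < (2 : ℝ) ^ (-k) →
      edist x y ^ s z ≤ edist x y ^ t z * ENNReal.ofReal (A * θ ^ k.natAbs) := by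
  obtain ⟨D₀, hD₀⟩ := Metric.isBounded_iff.1 hX.isBounded
  set D : ℝ := max 1 D₀ with hDdef
  have hD1 : 1 ≤ D := le_max_left _ _
  have hD0 : 0 < D := one_pos.trans_le hD1
  have hD : ∀ x y : X, dist x y ≤ D := fun x y =>
    (hD₀ (mem_univ x) (mem_univ y)).trans (le_max_right _ _)
  rcases isEmpty_or_nonempty X with hE | ⟨⟨x₀⟩⟩
  · exact ⟨1, 1 / 2, one_pos, by norm_num, by norm_num, fun k x => (hE.false x).elim⟩
  have hS0 : 0 ≤ S := hε.le.trans ((hst x₀).trans (hS x₀))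
  have hθpow : ∀ n : ℕ, ((2 : ℝ) ^ (-ε)) ^ n = ((2 : ℝ) ^ n) ^ (-ε) := fun n => by
    rw [← Real.rpow_natCast, ← Real.rpow_natCast, ← Real.rpow_mul (by norm_num),
      ← Real.rpow_mul (by norm_num), mul_comm]
  have hA1 : 1 ≤ (2 * D) ^ ε := Real.one_le_rpow (by linarith) hε.le
  have hA2 : 1 ≤ D ^ S := Real.one_le_rpow hD1 hS0
  refine ⟨(2 * D) ^ ε * D ^ S, 2 ^ (-ε), by positivity, by positivity,
    Real.rpow_lt_one_of_one_lt_of_neg (by norm_num) (by linarith), fun k x y z h1 h2 => ?_⟩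
  have hd : 0 < dist x y := lt_of_lt_of_le (by positivity) h1
  have hmain : dist x y ^ (s z - t z) ≤ (2 * D) ^ ε * D ^ S * ((2 : ℝ) ^ (-ε)) ^ k.natAbs := by
    rw [hθpow]
    -- For `k ≥ 0` the decay is `d ^ ε ≤ 2 ^ (-k * ε)`. For `k < 0` a nonempty shell forces `2 ^ |k|
    -- ≤ 2 * D`, so `(2 * D) ^ ε` absorbs the weight and `D ^ S` bounds the power of `d`.
    rcases le_or_gt 0 k with hk | hk
    · have h3 : dist x y ≤ ((2 : ℝ) ^ k.natAbs)⁻¹ := by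
        rw [← zpow_natCast, ← zpow_neg, Int.natAbs_of_nonneg hk]
        exact h2.le
      have h4 : dist x y ≤ 1 := h3.trans (inv_le_one_of_one_le₀ (one_le_pow₀ (by norm_num)))
      calc dist x y ^ (s z - t z) ≤ dist x y ^ ε :=
            Real.rpow_le_rpow_of_exponent_ge hd h4 (hst z)
        _ ≤ (((2 : ℝ) ^ k.natAbs)⁻¹) ^ ε := Real.rpow_le_rpow hd.le h3 hε.le
        _ = ((2 : ℝ) ^ k.natAbs) ^ (-ε) := by
            rw [Real.inv_rpow (by positivity), Real.rpow_neg (by positivity)]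
        _ ≤ _ := le_mul_of_one_le_left (by positivity) (one_le_mul_of_one_le_of_one_le hA1 hA2)
    · have h3 : (2 : ℝ) ^ k.natAbs ≤ 2 * D := by
        have e : (2 : ℝ) ^ k.natAbs = 2 * 2 ^ (-k - 1) := by
          rw [← zpow_natCast, Int.ofNat_natAbs_of_nonpos hk.le, ← zpow_one_add₀ (by norm_num)]
          congr 1; ring
        rw [e]
        linarith [hD x y]
      have h4 : 1 ≤ (2 * D) ^ ε * ((2 : ℝ) ^ k.natAbs) ^ (-ε) := by
        rw [Real.rpow_neg (by positivity), ← div_eq_mul_inv, one_le_div (by positivity)]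
        exact Real.rpow_le_rpow (by positivity) h3 hε.le
      calc dist x y ^ (s z - t z) ≤ D ^ (s z - t z) :=
            Real.rpow_le_rpow hd.le (hD x y) (hε.le.trans (hst z))
        _ ≤ D ^ S := Real.rpow_le_rpow_of_exponent_le hD1 (hS z)
        _ ≤ ((2 * D) ^ ε * ((2 : ℝ) ^ k.natAbs) ^ (-ε)) * D ^ S :=
            le_mul_of_one_le_left (by positivity) h4
        _ = _ := by ring
  rw [edist_dist, ENNReal.ofReal_rpow_of_pos hd, ENNReal.ofReal_rpow_of_pos hd,
    ← ENNReal.ofReal_mul (by positivity)]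
  refine ENNReal.ofReal_le_ofReal ?_
  calc dist x y ^ s z = dist x y ^ t z * dist x y ^ (s z - t z) := by
        rw [← Real.rpow_add hd]; congr 1; ring
    _ ≤ _ := by gcongr

lemma tsum_ofReal_pow_natAbs_ne_top {θ : ℝ} (h0 : 0 < θ) (h1 : θ < 1) :
    ∑' k : ℤ, ENNReal.ofReal (θ ^ k.natAbs) ≠ ∞ := by
  refine Summable.tsum_ofReal_ne_top ?_
  rw [summable_int_iff_summable_nat_and_neg]
  constructor <;> simpa using summable_geometric_of_lt_one h0.le h1

variable {X : Type*} [MetricSpace X] [MeasurableSpace X] {μ : Measure X} {Q s t p lam : X → ℝ}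

/-- The compact embedding for any quasi-normed space whose elements have scalar gradients
controlled by the quasi-norm. -/
lemma compactEmbedsHolder_of_gradient [BorelSpace X] (hμ : BallsPosFinite μ)
    (hX : TotallyBounded (univ : Set X)) (hQ : IsBddLogExponent μ Q)
    (hreg : LowerAhlforsRegular μ Q) (ht : IsBddLogExponent μ t) (hp : IsBddLogExponent μ p)
    (htp : EssLL μ Q (fun x => t x * p x)) (hlam : IsBddExponent μ lam)
    (hgap : UnifLL lam (fun x => t x - Q x / p x)) {mem : (X → EReal) → Prop}
    {semi : (X → EReal) → ℝ≥0∞}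
    (hmem : ∀ u, mem u → (∀ᵐ x ∂μ, u x ≠ ⊤ ∧ u x ≠ ⊥) ∧
      MemLpVar μ (fun x => ENNReal.ofReal (p x)) u ∧ semi u < ∞)
    {C₀ : ℝ} (hC₀ : 1 ≤ C₀)
    (hgrad : ∀ (u : X → EReal) (L : ℝ), mem u → 0 < L → semi u < ENNReal.ofReal L →
      ∃ g, IsHajlaszGradient μ t u g ∧ modular μ (fun x => ENNReal.ofReal (p x))
        (fun x => g x / ENNReal.ofReal (L * C₀)) ≤ 1) :
    CompactEmbedsHolder μ mem
      (fun u => lpNorm μ (fun x => ENNReal.ofReal (p x)) (fun x => (u x).abs) + semi u) lam := by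
  have := hμ.isOpenPosMeasure
  obtain ⟨b, K, c, S, a, H⟩ := exists_admissibleData hμ hQ ht hp hreg htp
  have hp0 := hp.bdd.pos
  have hαc : Continuous fun x => t x - Q x / p x :=
    ht.continuous.sub (hQ.continuous.div hp.continuous fun x => (hp0 x).ne')
  obtain ⟨C, hC, hbound⟩ := H.exists_holder_bound hp.bdd.measurable
  have hC₀' : 0 < C₀ := by linarith
  refine compactEmbedsHolder_of_ae_bound (C := C * C₀) (A := S) hX hαc H.a_pos H.le_smoothness
    (fun x => ?_) hlam.pos hgap (by positivity) (fun u hu => ?_) fun u L hu hL hn => ?_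
  · have := H.t_le x
    have := div_pos (hQ.bdd.pos x) (hp0 x)
    linarith
  · obtain ⟨-, h2, h3⟩ := hmem u hu
    exact ENNReal.add_lt_top.2 ⟨lpNorm_lt_top H.c_pos H.le_p h2, h3⟩
  · obtain ⟨h1, h2, h3⟩ := hmem u hu
    obtain ⟨g, hg, hmod⟩ := hgrad u L hu hL (le_add_self.trans_lt hn)
    have hmu : modular μ (fun x => ENNReal.ofReal (p x))
        (fun x => (u x).abs / ENNReal.ofReal (L * C₀)) ≤ 1 := by
      refine modular_div_le_one_of_lpNorm_lt hp0 ((le_self_add.trans_lt hn).trans_le ?_)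
      exact ENNReal.ofReal_le_ofReal (le_mul_of_one_le_right hL.le hC₀)
    obtain ⟨N, hN, hcoe, hsup, hhol⟩ := hbound u g (L * C₀) (by positivity) h2.1 h1 hg hmu hmod
    have e : C * C₀ * L = C * (L * C₀) := by ring
    exact ⟨N, hN, hcoe, fun x hx => e ▸ hsup x hx, fun x y hx hy => e ▸ hhol x y hx hy⟩

/-- Every `ℓ^q` norm dominates the supremum, so `q` plays no further role. -/
theorem compactEmbedsHolder_tl [BorelSpace X] (hμ : BallsPosFinite μ)
    (hX : TotallyBounded (univ : Set X)) (hQ : IsBddLogExponent μ Q)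
    (hreg : LowerAhlforsRegular μ Q) (hs : IsBddLogExponent μ s) (hp : IsBddLogExponent μ p)
    (hsp : EssLL μ Q (fun x => s x * p x)) {q : X → ℝ≥0∞} (hq : IsExponent μ q)
    (hlam : IsBddExponent μ lam) (hgap : UnifLL lam (fun x => s x - Q x / p x)) :
    CompactEmbedsHolder μ (MemTL μ s p q) (tlNorm μ s p q) lam := by
  refine compactEmbedsHolder_of_gradient (semi := tlSeminorm μ s p q) hμ hX hQ hreg hs hp hsp hlam
    hgap (fun u hu => ⟨hu.finite_ae, hu.memLp, hu.seminorm_lt_top⟩) le_rfl fun u L hu hL hn => ?_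
  obtain ⟨g, hg⟩ := iInf_lt_iff.1 hn
  obtain ⟨hgv, hgn⟩ := iInf_lt_iff.1 hg
  refine ⟨_, hgv.isHajlaszGradient_iSup, ?_⟩
  rw [mul_one]
  refine (modular_mono hp.bdd.pos fun x => ?_).trans
    (modular_div_le_one_of_lpNorm_lt hp.bdd.pos hgn)
  exact ENNReal.div_le_div_right (iSup_le fun k => le_seqNorm (hq.pos x) (fun k => g k x) k) _

lemma exists_seqLpModular_le_one {q : X → ℝ≥0∞} {u : X → EReal} {M : ℝ≥0∞}
    (hn : besovSeminorm μ s p q u < M) :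
    ∃ (g : ℤ → X → ℝ≥0∞) (m : ℝ≥0∞), IsVectorGradient μ s u g ∧ m ≤ M ∧
      seqLpModular μ (fun x => ENNReal.ofReal (p x)) q (fun k x => g k x / m) ≤ 1 := by
  obtain ⟨g, hg⟩ := iInf_lt_iff.1 hn
  obtain ⟨hgv, hgn⟩ := iInf_lt_iff.1 hg
  obtain ⟨m, ⟨-, -, hm⟩, hmM⟩ := sInf_lt_iff.1 hgn
  exact ⟨g, m, hgv, hmM.le, hm⟩

/-- The modular of `⨆ k, g k / m` is at most the sum of the modulars, hence at most `2 ^ (B * P)`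
times the sum of the levels, which is at most one. The power `1 / c` in `C₀` rescales this to a
modular at most one. -/
theorem compactEmbedsHolder_besov_of_le [BorelSpace X] (hμ : BallsPosFinite μ)
    (hX : TotallyBounded (univ : Set X)) (hQ : IsBddLogExponent μ Q)
    (hreg : LowerAhlforsRegular μ Q) (hs : IsBddLogExponent μ s) (hp : IsBddLogExponent μ p)
    (hsp : EssLL μ Q (fun x => s x * p x)) {q : X → ℝ≥0∞} (hq : IsExponent μ q)
    (hqp : ∀ᵐ x ∂μ, q x ≤ ENNReal.ofReal (p x))
    (hlam : IsBddExponent μ lam) (hgap : UnifLL lam (fun x => s x - Q x / p x)) :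
    CompactEmbedsHolder μ (MemBesov μ s p q) (besovNorm μ s p q) lam := by
  have := hμ.isOpenPosMeasure
  have hp0 := hp.bdd.pos
  obtain ⟨c, P, hc, hP, hpb⟩ := hp.exists_bounds
  obtain ⟨B, hB0, hB⟩ := hq.exists_inv_le
  have hK : (1 : ℝ) ≤ 2 ^ (B * P) := Real.one_le_rpow (by norm_num) (by positivity)
  refine compactEmbedsHolder_of_gradient (semi := besovSeminorm μ s p q)
    (C₀ := (2 ^ (B * P)) ^ (1 / c)) hμ hX hQ hreg hs hp hsp hlam
    hgap (fun u hu => ⟨hu.finite_ae, hu.memLp, hu.seminorm_lt_top⟩)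
    (Real.one_le_rpow hK (by positivity)) fun u L hu hL hn => ?_
  obtain ⟨g, m, hgv, hmL, hmod⟩ := exists_seqLpModular_le_one hn
  refine ⟨_, hgv.isHajlaszGradient_iSup, ?_⟩
  have hsup : modular μ (fun x => ENNReal.ofReal (p x)) (fun x => ⨆ k, g k x / m) ≤
      ENNReal.ofReal (2 ^ (B * P)) := by
    refine (modular_iSup_le hp0 hp.bdd.measurable fun k => (hgv.1 k).div_const m).trans ?_
    refine (ENNReal.tsum_le_tsum fun k => lintegral_rpow_le_level hp0 (fun x => (hpb x).2) hqp
      hq.pos hB0 hB _ ((ENNReal.le_tsum k).trans hmod)).trans ?_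
    rw [ENNReal.tsum_mul_left]
    exact mul_le_of_le_one_right' hmod
  refine le_trans (modular_mono hp0 fun x => ?_)
    (modular_div_le_one hc (fun x => (hpb x).1) hK hsup)
  rw [← ENNReal.iSup_div, ENNReal.ofReal_mul hL.le, ENNReal.div_eq_inv_mul, ENNReal.div_eq_inv_mul,
    ENNReal.div_eq_inv_mul, ← mul_assoc]
  gcongr
  rw [ENNReal.mul_inv (Or.inr ENNReal.ofReal_ne_top) (Or.inl ENNReal.ofReal_ne_top), mul_comm]
  gcongr

/-- The weights `A * θ ^ |k|` turn uniformly bounded modulars into a geometric series. In `C₀`, the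
factor `C₁` absorbs `A` and the level loss `2 ^ B`, and `K ^ (1 / c)` absorbs the sum of the series.
-/
theorem compactEmbedsHolder_besov_of_lt [BorelSpace X] (hμ : BallsPosFinite μ)
    (hX : TotallyBounded (univ : Set X)) (hQ : IsBddLogExponent μ Q)
    (hreg : LowerAhlforsRegular μ Q) (hs : IsBddLogExponent μ s) (ht : IsBddLogExponent μ t)
    (hp : IsBddLogExponent μ p) (htp : EssLL μ Q (fun x => t x * p x)) {ε : ℝ} (hε : 0 < ε)
    (hst : ∀ x, ε ≤ s x - t x) {q : X → ℝ≥0∞} (hq : IsExponent μ q)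
    (hlam : IsBddExponent μ lam) (hgap : UnifLL lam (fun x => t x - Q x / p x)) :
    CompactEmbedsHolder μ (MemBesov μ s p q) (besovNorm μ s p q) lam := by
  have := hμ.isOpenPosMeasure
  have hp0 := hp.bdd.pos
  obtain ⟨c, P, hc, hP, hpb⟩ := hp.exists_bounds
  obtain ⟨_, S, _, _, hsb⟩ := hs.exists_bounds
  obtain ⟨B, hB0, hB⟩ := hq.exists_inv_le
  obtain ⟨A, θ, hA, hθ0, hθ1, hw⟩ := exists_weight hX (S := S) hε hst
    fun x => by linarith [(hsb x).2, ht.bdd.pos x]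
  have hθc : θ ^ c < 1 := Real.rpow_lt_one hθ0.le hθ1 hc
  set T := ∑' k : ℤ, ENNReal.ofReal ((θ ^ c) ^ k.natAbs) with hTdef
  have hT : T ≠ ∞ := tsum_ofReal_pow_natAbs_ne_top (by positivity) hθc
  set K : ℝ := max 1 T.toReal with hKdef
  have hK : 1 ≤ K := le_max_left _ _
  have hK0 : 0 < K := one_pos.trans_le hK
  set C₁ : ℝ := max 1 (A * 2 ^ B) with hC₁
  have hC₁1 : 1 ≤ C₁ := le_max_left _ _
  have hKc : 1 ≤ K ^ (1 / c) := Real.one_le_rpow hK (by positivity)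
  refine compactEmbedsHolder_of_gradient (semi := besovSeminorm μ s p q)
    (C₀ := C₁ * K ^ (1 / c)) hμ hX hQ hreg ht hp htp hlam
    hgap (fun u hu => ⟨hu.finite_ae, hu.memLp, hu.seminorm_lt_top⟩)
    (one_le_mul_of_one_le_of_one_le hC₁1 hKc) fun u L hu hL hn => ?_
  obtain ⟨g, m, hgv, hmL, hmod⟩ := exists_seqLpModular_le_one hn
  refine ⟨_, hgv.isHajlaszGradient hw, ?_⟩
  have hterm : ∀ k : ℤ, ∫⁻ x, (ENNReal.ofReal (θ ^ k.natAbs) * (g k x / m / 2 ^ B)) ^ p x ∂μ ≤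
      ENNReal.ofReal ((θ ^ c) ^ k.natAbs) := fun k => by
    calc _ ≤ ∫⁻ x, ENNReal.ofReal ((θ ^ c) ^ k.natAbs) * (g k x / m / 2 ^ B) ^ p x ∂μ := by
          refine lintegral_mono fun x => ?_
          rw [ENNReal.mul_rpow_of_nonneg _ _ (hp0 x).le, ENNReal.ofReal_rpow_of_pos (by positivity)]
          -- As `θ < 1` and `p x ≥ c`, the weight raised to `p x` is at most `(θ ^ c) ^ |k|`,
          -- uniformly in `x`.
          gcongr ENNReal.ofReal ?_ * _
          rw [← Real.rpow_natCast, ← Real.rpow_natCast, ← Real.rpow_mul hθ0.le,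
            ← Real.rpow_mul hθ0.le]
          apply Real.rpow_le_rpow_of_exponent_ge hθ0 hθ1.le
          rw [mul_comm]
          exact mul_le_mul_of_nonneg_left (hpb x).1 (Nat.cast_nonneg _)
      _ = ENNReal.ofReal ((θ ^ c) ^ k.natAbs) * ∫⁻ x, (g k x / m / 2 ^ B) ^ p x ∂μ :=
          lintegral_const_mul' _ _ ENNReal.ofReal_ne_top
      _ ≤ _ := mul_le_of_le_one_right' (lintegral_div_rpow_le_one hp0 hB (fun x => g k x / m)
          ((ENNReal.le_tsum k).trans hmod))
  have hsup : modular μ (fun x => ENNReal.ofReal (p x))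
      (fun x => ⨆ k : ℤ, ENNReal.ofReal (θ ^ k.natAbs) * (g k x / m / 2 ^ B)) ≤
      ENNReal.ofReal K := by
    refine (modular_iSup_le hp0 hp.bdd.measurable fun k =>
      (((hgv.1 k).div_const m).div_const _).const_mul _).trans ?_
    refine (ENNReal.tsum_le_tsum hterm).trans ?_
    rw [← hTdef, ← ENNReal.ofReal_toReal hT]
    exact ENNReal.ofReal_le_ofReal (le_max_right _ _)
  refine le_trans (modular_mono hp0 fun x => ?_)
    (modular_div_le_one hc (fun x => (hpb x).1) hK hsup)
  have hC₁0 : 0 < C₁ := one_pos.trans_le hC₁1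
  rw [ENNReal.iSup_div, ENNReal.iSup_div]
  refine iSup_mono fun k => ?_
  have hA' : ENNReal.ofReal A * 2 ^ B ≤ ENNReal.ofReal C₁ := by
    have e : (2 : ℝ≥0∞) ^ B = ENNReal.ofReal (2 ^ B) := by
      rw [← ENNReal.ofReal_rpow_of_pos (by norm_num)]; norm_num
    rw [e, ← ENNReal.ofReal_mul hA.le]
    exact ENNReal.ofReal_le_ofReal (le_max_right _ _)
  have hAne : ENNReal.ofReal A ≠ 0 := by simpa using hA
  calc ENNReal.ofReal (A * θ ^ k.natAbs) * g k x / ENNReal.ofReal (L * (C₁ * K ^ (1 / c)))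
      ≤ ENNReal.ofReal (A * θ ^ k.natAbs) * g k x /
        (m * (ENNReal.ofReal A * 2 ^ B * ENNReal.ofReal (K ^ (1 / c)))) := by
        refine ENNReal.div_le_div_left ?_ _
        rw [ENNReal.ofReal_mul hL.le, ENNReal.ofReal_mul hC₁0.le]
        gcongr
    _ = _ := by
        have h2 : (2 : ℝ≥0∞) ^ B ≠ 0 := (ENNReal.rpow_pos (by norm_num) (by norm_num)).ne'
        have h2' : (2 : ℝ≥0∞) ^ B ≠ ∞ := ENNReal.rpow_ne_top_of_nonneg hB0 (by norm_num)
        have hκ : ENNReal.ofReal (K ^ (1 / c)) ≠ 0 := by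
          simpa using Real.rpow_pos_of_pos hK0 (1 / c)
        have hAtop : ENNReal.ofReal A ≠ ∞ := ENNReal.ofReal_ne_top
        generalize hκeq : ENNReal.ofReal (K ^ (1 / c)) = κ at hκ ⊢
        have hκ' : κ ≠ ∞ := hκeq ▸ ENNReal.ofReal_ne_top
        rw [ENNReal.ofReal_mul hA.le]
        simp only [div_eq_mul_inv]
        rw [ENNReal.mul_inv (Or.inr (ENNReal.mul_ne_top (ENNReal.mul_ne_top hAtop h2')
            hκ')) (Or.inr (mul_ne_zero (mul_ne_zero hAne h2) hκ)),
          ENNReal.mul_inv (Or.inr hκ') (Or.inr hκ),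
          ENNReal.mul_inv (Or.inr h2') (Or.inr h2)]
        calc _ = (ENNReal.ofReal A * (ENNReal.ofReal A)⁻¹) * (ENNReal.ofReal (θ ^ k.natAbs) *
              (g k x * m⁻¹ * (2 ^ B)⁻¹) * κ⁻¹) := by ring
          _ = _ := by rw [ENNReal.mul_inv_cancel hAne hAtop, one_mul]

end Embeddings

end VarExp

/-! ### The main theorem -/

theorem mainTheorem10 {X : Type*} [MetricSpace X] [MeasurableSpace X] [BorelSpace X]
    (μ : Measure X) (hμ : VarExp.BallsPosFinite μ)
    (hX : TotallyBounded (Set.univ : Set X))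
    (Q s p : X → ℝ)
    (hQ : VarExp.IsBddLogExponent μ Q)
    (hreg : VarExp.LowerAhlforsRegular μ Q)
    (hs : VarExp.IsBddLogExponent μ s)
    (hp : VarExp.IsBddLogExponent μ p)
    (hsp : VarExp.EssLL μ Q (fun x => s x * p x)) :
    (∀ q : X → ℝ≥0∞, VarExp.IsExponent μ q →
      ∀ lam : X → ℝ, VarExp.IsBddExponent μ lam →
        VarExp.UnifLL lam (fun x => s x - Q x / p x) →
        VarExp.CompactEmbedsHolder μ (VarExp.MemTL μ s p q) (VarExp.tlNorm μ s p q) lam) ∧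
    (∀ q : X → ℝ≥0∞, VarExp.IsExponent μ q →
      (∀ᵐ x ∂μ, q x ≤ ENNReal.ofReal (p x)) →
      ∀ lam : X → ℝ, VarExp.IsBddExponent μ lam →
        VarExp.UnifLL lam (fun x => s x - Q x / p x) →
        VarExp.CompactEmbedsHolder μ (VarExp.MemBesov μ s p q) (VarExp.besovNorm μ s p q) lam) ∧
    (∀ q : X → ℝ≥0∞, VarExp.IsExponent μ q →
      ∀ t : X → ℝ, VarExp.IsBddLogExponent μ t →
        VarExp.EssLL μ Q (fun x => t x * p x) →
        VarExp.EssLL μ (fun x => t x * p x) (fun x => s x * p x) →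
      ∀ lam : X → ℝ, VarExp.IsBddExponent μ lam →
        VarExp.UnifLL lam (fun x => t x - Q x / p x) →
        VarExp.CompactEmbedsHolder μ (VarExp.MemTL μ s p q) (VarExp.tlNorm μ s p q) lam ∧
        VarExp.CompactEmbedsHolder μ (VarExp.MemBesov μ s p q) (VarExp.besovNorm μ s p q) lam) := by
  have := hμ.isOpenPosMeasure
  refine ⟨fun q hq lam hlam hgap => ?_, fun q hq hqp lam hlam hgap => ?_,
    fun q hq t ht htp htsp lam hlam hgap => ?_⟩
  · exact VarExp.compactEmbedsHolder_tl hμ hX hQ hreg hs hp hsp hq hlam hgap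
  · exact VarExp.compactEmbedsHolder_besov_of_le hμ hX hQ hreg hs hp hsp hq hqp hlam hgap
  · obtain ⟨c, hc, hcle⟩ := htsp
    obtain ⟨_, P, _, hP, hpb⟩ := hp.exists_bounds
    -- Dividing the gap in `tp ≪ sp` by the upper bound `P` of `p` gives a pointwise gain of
    -- smoothness.
    have hst : ∀ x, c / P ≤ s x - t x := fun x => by
      have h1 : c ≤ s x * p x - t x * p x :=
        VarExp.forall_le_of_ae_le (μ := μ) continuous_const
          ((hs.continuous.mul hp.continuous).sub (ht.continuous.mul hp.continuous)) hcle x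
      rw [← sub_mul] at h1
      have h2 : 0 ≤ s x - t x :=
        (pos_of_mul_pos_left (hc.trans_le h1) (hp.bdd.pos x).le).le
      rw [div_le_iff₀ hP]
      exact h1.trans (mul_le_mul_of_nonneg_left (hpb x).2 h2)
    have hcP : 0 < c / P := by positivity
    refine ⟨?_, VarExp.compactEmbedsHolder_besov_of_lt hμ hX hQ hreg hs ht hp htp hcP hst hq hlam
      hgap⟩
    -- Since `s ≥ t`, the gap below `t - Q / p` is also a gap below `s - Q / p`, so the first part
    -- applies.
    obtain ⟨δ, hδ, hgap⟩ := hgap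
    refine VarExp.compactEmbedsHolder_tl hμ hX hQ hreg hs hp hsp hq hlam ⟨δ, hδ, fun x => ?_⟩
    linarith [hgap x, hst x]
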